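/- **Setting.** Let $d\ge 1$. An isthmus graph $G$ is obtained from the disjoint union of a graph $A$ with vertices $v_{1-a},\dots,v_0$, a path $I$ with vertices (in order) $v_1,\dots,v_m$, and a graph $B$ with vertices $v_{m+1},\dots,v_{m+b}$, where $A$ and $B$ are finite simple graphs, each connected or empty, by adding the edge $(v_0,v_1)$ if $a>0$ and the edge $(v_m,v_{m+1})$ if $b>0$. Given a function $f\colon\{1,\dots,d\}\to\{v_1,\dots,v_m\}$, the $\mathbb Z^d$-periodic isthmus-connected graph $\Gamma$ is $\mathbb Z^d\times G$ (copies of $G$) together with the edges between $(\alpha,f(j))$ and $(\alpha+e_j,f(j))$ for all $\alpha\in\mathbb Z^d$ and $1\le j\le d$. Let $V$ be a $\mathbb Z^d$-periodic real function on the vertices of $\Gamma$ (the potential) and $E$ a $\mathbb Z^d$-periodic real function on its edges (the edge weights). The Floquet matrix $H(z)$, for $z\in(\mathbb C^\times)^d$, has rows and columns indexed by the vertices of $G$ and entries $$H(z)_{v,u}=V(v)\,\delta_{v,u}+\sum_{\alpha:\ (0,v)\sim(\alpha,u)}E\big((0,v),(\alpha,u)\big)\,z^{\alpha}.$$ Put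 $D(z,\lambda)=\det(H(z)-\lambda)$. The Bloch variety is $\{(z,\lambda)\in(\mathbb C^\times)^d\times\mathbb C: D(z,\lambda)=0\}$. A point $(z,\lambda)\in(\mathbb C^\times)^d\times\mathbb C$ is a critical point if $D=\partial D/\partial z_1=\dots=\partial D/\partial z_d=0$ there; it is nondegenerate if the Jacobian matrix of these $d+1$ functions with respect to the $d+1$ variables $(z,\lambda)$ is invertible there. A corner point is a point $x$ with $x_j=\pm1$ for all $j$. For $1\le s\le m$ let $P_s(z,\lambda)$ and $Q_s(z,\lambda)$ be the principal minors of $H(z)-\lambda$ on the vertices $v_i$ with $i<s$ and with $i>s$, respectively (an empty minor is $1$). The parameters $(V,E)$ are called generic if no edge weight vanishes and, for every corner point $x$ and all $1\le r\le s\le m$, no two of the polynomials $P_r(x,\lambda)$, $Q_s(x,\lambda)$, $D(x,\lambda)$ in $\lambda$ have a common root. For $z$ in the torus $\mathbb T^d$ of unit complex numbers, $H(z)$ is Hermitian; its eigenvalues in decreasing order, with multiplicity, are the spectral band functions $\lambda_k\colon\mathbb T^d\to\mathbb R$. An extremum of the dispersion relation is a point $(z,\lambda_k(z))$, for some $k$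 and some local maximum or minimum $z$ of $\lambda_k$. **Theorem.** Let $\Gamma$ be a $\mathbb Z^d$-periodic isthmus-connected graph. 1. If $(V,E)$ is generic in the above sense, then the critical points are exactly the points $(x,\lambda)$ of the Bloch variety for which $x$ is a corner point, and every critical point is nondegenerate. 2. The spectral edges conjecture holds for $\Gamma$: there is a polynomial in the parameters $(V,E)$, not vanishing identically, such that, for all $(V,E)$ at which it does not vanish, the following holds. Every extremum of the dispersion relation is isolated among these extrema; it lies on the graph of only one band function; and that band function, in the angular coordinates of $\mathbb T^d$, is twice continuously differentiable near $z$ with invertible Hessian matrix at $z$. 3. The spectral edges conjecture holds for Schrödinger operators on $\Gamma$: there is a polynomial in the parameters, not vanishing identically on the set of those $(V,E)$ for which $E$ is constant $1$, such that, for all $(V,E)$ with $E$ constant $1$ at which it does not vanish, the conclusion of part 2 holds. -/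

import Mathlib

open Filter Topology

noncomputable section

/-- Translation of a vertex of a graph with vertex set `ℤ^d × W` by `c ∈ ℤ^d`. -/
def shiftVert {d : ℕ} {W : Type} (c : Fin d → ℤ) (p : (Fin d → ℤ) × W) : (Fin d → ℤ) × W :=
  (c + p.1, p.2)

/-- A `ℤ^d`-periodic graph with fundamental domain (a copy of) `W`: the free action of `ℤ^d` is by
translation, and there are finitely many orbits of edges as soon as `W` is finite. -/
structure PeriodicGraph (d : ℕ) (W : Type) where
  graph : SimpleGraph ((Fin d → ℤ) × W)
  periodic : ∀ (c : Fin d → ℤ) (p q : (Fin d → ℤ) × W),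
    graph.Adj p q → graph.Adj (shiftVert c p) (shiftVert c q)
  cocompact : ∀ v u : W, {c : Fin d → ℤ | graph.Adj (0, v) (c, u)}.Finite

/-- A labeling: a periodic real potential `V` and periodic real edge weights `E`. -/
structure Labeling {d : ℕ} {W : Type} (Γ : PeriodicGraph d W) where
  V : (Fin d → ℤ) × W → ℝ
  E : Γ.graph.edgeSet → ℝ
  V_periodic : ∀ (c : Fin d → ℤ) (p : (Fin d → ℤ) × W), V (shiftVert c p) = V p
  E_periodic : ∀ (c : Fin d → ℤ) (p q : (Fin d → ℤ) × W) (h : Γ.graph.Adj p q),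
    E ⟨s(shiftVert c p, shiftVert c q), Γ.periodic c p q h⟩ = E ⟨s(p, q), h⟩

namespace Labeling

variable {d : ℕ} {W : Type} {Γ : PeriodicGraph d W}

open Classical in
/-- The term `E(v, c+u) z^c` if `(v, c+u)` is an edge, and `0` otherwise. -/
def edgeTerm (L : Labeling Γ) (z : Fin d → ℂ) (v u : W) (c : Fin d → ℤ) : ℂ :=
  if h : Γ.graph.Adj (0, v) (c, u) then
    (L.E ⟨s(((0 : Fin d → ℤ), v), (c, u)), h⟩ : ℂ) * ∏ i, z i ^ c i
  else 0

open Classical in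
/-- The Floquet matrix `H(z)`. -/
def floquet (L : Labeling Γ) (z : Fin d → ℂ) : Matrix W W ℂ :=
  Matrix.of fun v u => (if v = u then (L.V (0, v) : ℂ) else 0) + ∑ᶠ c, L.edgeTerm z v u c

/-- The characteristic matrix `H(z) - λ`. -/
def charMat [Fintype W] [DecidableEq W] (L : Labeling Γ) (p : (Fin d → ℂ) × ℂ) : Matrix W W ℂ :=
  L.floquet p.1 - Matrix.scalar W p.2

/-- The dispersion polynomial `D(z, λ) = det (H(z) - λ)`, as a function. -/
def dispersion [Fintype W] [DecidableEq W] (L : Labeling Γ) (p : (Fin d → ℂ) × ℂ) : ℂ :=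
  (L.charMat p).det

/-- The Bloch variety in `(ℂ^×)^d × ℂ`. -/
def blochVariety [Fintype W] [DecidableEq W] (L : Labeling Γ) : Set ((Fin d → ℂ) × ℂ) :=
  {p | (∀ i, p.1 i ≠ 0) ∧ L.dispersion p = 0}

end Labeling

/-- Partial derivative of a function of `(z, λ)`: with respect to `z_j` for the index `some j`, and
with respect to `λ` for the index `none`. -/
def pderivAt {d : ℕ} (i : Option (Fin d)) (F : (Fin d → ℂ) × ℂ → ℂ) (p : (Fin d → ℂ) × ℂ) : ℂ :=
  match i with
  | some j => deriv (fun t => F (Function.update p.1 j t, p.2)) (p.1 j)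
  | none => deriv (fun t => F (p.1, t)) p.2

namespace Labeling

variable {d : ℕ} {W : Type} [Fintype W] [DecidableEq W] {Γ : PeriodicGraph d W}

/-- The left-hand sides `D, ∂D/∂z_1, …, ∂D/∂z_d` of the critical point equations. -/
def critEqn (L : Labeling Γ) : Option (Fin d) → (Fin d → ℂ) × ℂ → ℂ
  | none => L.dispersion
  | some j => pderivAt (some j) L.dispersion

/-- Critical points (of the function `λ` on the Bloch variety). -/
def IsCritical (L : Labeling Γ) (p : (Fin d → ℂ) × ℂ) : Prop :=
  (∀ i, p.1 i ≠ 0) ∧ ∀ r, L.critEqn r p = 0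

/-- The Jacobian matrix of the critical point equations. -/
def critJacobian (L : Labeling Γ) (p : (Fin d → ℂ) × ℂ) :
    Matrix (Option (Fin d)) (Option (Fin d)) ℂ :=
  Matrix.of fun r c => pderivAt c (L.critEqn r) p

/-- Nondegeneracy of a critical point: the Jacobian of the critical point equations is invertible.
At a critical point, its determinant is, up to sign, `∂D/∂λ` times the determinant of
`(∂²D/∂z_i∂z_j)`; so this says that the Bloch variety is smooth there and that the Hessian is
invertible. -/
def IsNondegenerate (L : Labeling Γ) (p : (Fin d → ℂ) × ℂ) : Prop :=
  (L.critJacobian p).det ≠ 0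

end Labeling

/-- Corner points. -/
def IsCornerPoint {d : ℕ} (z : Fin d → ℂ) : Prop := ∀ i, z i = 1 ∨ z i = -1

/-! ### Spectral band functions on the compact torus -/

namespace Labeling

variable {d : ℕ} {W : Type} {Γ : PeriodicGraph d W}

theorem star_edgeTerm (L : Labeling Γ) (z : Fin d → Circle) (v u : W) (c : Fin d → ℤ) :
    star (L.edgeTerm (fun i => (z i : ℂ)) v u c) = L.edgeTerm (fun i => (z i : ℂ)) u v (-c) := by
  have key : ∀ (v u : W) (c : Fin d → ℤ), Γ.graph.Adj (0, v) (c, u) →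
      Γ.graph.Adj (0, u) (-c, v) := by
    intro v u c h
    have := Γ.periodic (-c) _ _ h.symm
    simpa [shiftVert] using this
  by_cases h : Γ.graph.Adj (0, v) (c, u)
  · have h' := key v u c h
    have hE : L.E ⟨s(((0 : Fin d → ℤ), u), (-c, v)), h'⟩
        = L.E ⟨s(((0 : Fin d → ℤ), v), (c, u)), h⟩ := by
      rw [← L.E_periodic (-c) _ _ h]
      congr 2
      simp [shiftVert, Sym2.eq_swap]
    rw [edgeTerm, edgeTerm, dif_pos h, dif_pos h', hE]
    simp only [star_mul', Complex.star_def, Complex.conj_ofReal, map_prod, map_zpow₀,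
      Pi.neg_apply, zpow_neg]
    congr 1
    refine Finset.prod_congr rfl fun i _ => ?_
    rw [← Circle.coe_inv_eq_conj, Circle.coe_inv, inv_zpow]
  · have h' : ¬ Γ.graph.Adj (0, u) (-c, v) := fun h' => h (by simpa using key u v (-c) h')
    rw [edgeTerm, edgeTerm, dif_neg h, dif_neg h', star_zero]

theorem floquet_isHermitian (L : Labeling Γ) (z : Fin d → Circle) :
    (L.floquet fun i => (z i : ℂ)).IsHermitian := by
  ext v u
  have h1 : star (∑ᶠ c, L.edgeTerm (fun i => (z i : ℂ)) u v c)
      = ∑ᶠ c, L.edgeTerm (fun i => (z i : ℂ)) v u c := by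
    have h := (starAddEquiv (R := ℂ)).map_finsum (fun c => L.edgeTerm (fun i => (z i : ℂ)) u v c)
    simp only [starAddEquiv_apply] at h
    rw [h, ← finsum_comp_equiv (Equiv.neg (Fin d → ℤ))]
    refine finsum_congr fun c => ?_
    rw [star_edgeTerm]
    simp
  simp only [floquet, Matrix.conjTranspose_apply, Matrix.of_apply, star_add, h1]
  congr 1
  by_cases huv : u = v
  · subst huv; simp
  · simp [huv, Ne.symm huv]

variable [Fintype W] [DecidableEq W]

/-- The `k`-th spectral band function on the compact torus: the `k`-th eigenvalue of `H(z)`, in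
decreasing order and with multiplicity. -/
def band (L : Labeling Γ) (k : Fin (Fintype.card W)) (z : Fin d → Circle) : ℝ :=
  (L.floquet_isHermitian z).eigenvalues₀ k

/-- The extrema of the dispersion relation: the points `(z, λ_k(z))` such that the band function
`λ_k` has a local maximum or minimum at `z`. -/
def extrema (L : Labeling Γ) : Set ((Fin d → Circle) × ℝ) :=
  {p | ∃ k, IsLocalExtr (L.band k) p.1 ∧ L.band k p.1 = p.2}

/-- A band function near `z`, in angular (quasi-momentum) coordinates centered at `z`. -/
def localBand (L : Labeling Γ) (k : Fin (Fintype.card W)) (z : Fin d → Circle) :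
    (Fin d → ℝ) → ℝ :=
  fun θ => L.band k fun j => z j * Circle.exp (θ j)

/-- The Hessian matrix of a band function at `z`, in angular coordinates. -/
def bandHessian (L : Labeling Γ) (k : Fin (Fintype.card W)) (z : Fin d → Circle) :
    Matrix (Fin d) (Fin d) ℝ :=
  Matrix.of fun i j => iteratedFDeriv ℝ 2 (L.localBand k z) 0 ![Pi.single i 1, Pi.single j 1]

/-- The extrema of the dispersion relation are isolated, nondegenerate, and each occurs on a single
spectral band function. -/
def HasGoodSpectralEdges (L : Labeling Γ) : Prop :=
  ∀ (k : Fin (Fintype.card W)) (z : Fin d → Circle), IsLocalExtr (L.band k) z →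
    (∀ᶠ p in 𝓝[≠] (z, L.band k z), p ∉ L.extrema) ∧
    (ContDiffAt ℝ 2 (L.localBand k z) 0 ∧ (L.bandHessian k z).det ≠ 0) ∧
    ∀ k', k' ≠ k → L.band k' z ≠ L.band k z

/-- The value at a labeling of a polynomial in the parameters. -/
def evalParams (L : Labeling Γ)
    (F : MvPolynomial (((Fin d → ℤ) × W) ⊕ Γ.graph.edgeSet) ℝ) : ℝ :=
  MvPolynomial.eval (Sum.elim L.V L.E) F

end Labeling

/-- A property holds for generic members of a family `S` of labelings: it holds away from the
vanishing of a polynomial in the (periodic) values of the potential and of the edge weights which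
does not vanish identically on `S`. -/
def HoldsGenerically {d : ℕ} {W : Type} {Γ : PeriodicGraph d W} (S : Set (Labeling Γ))
    (P : Labeling Γ → Prop) : Prop :=
  ∃ F : MvPolynomial (((Fin d → ℤ) × W) ⊕ Γ.graph.edgeSet) ℝ,
    (∃ L ∈ S, L.evalParams F ≠ 0) ∧ ∀ L ∈ S, L.evalParams F ≠ 0 → P L

/-- The spectral edges conjecture for discrete periodic operators on `Γ`. -/
def SpectralEdgesConjecture {d : ℕ} {W : Type} [Fintype W] [DecidableEq W]
    (Γ : PeriodicGraph d W) : Prop :=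
  HoldsGenerically (Set.univ : Set (Labeling Γ)) Labeling.HasGoodSpectralEdges

/-- The spectral edges conjecture for discrete periodic Schrödinger operators on `Γ`: all edge
weights are `1`, and the potential is generic. -/
def SchrodingerSpectralEdgesConjecture {d : ℕ} {W : Type} [Fintype W] [DecidableEq W]
    (Γ : PeriodicGraph d W) : Prop :=
  HoldsGenerically {L : Labeling Γ | ∀ e, L.E e = 1} Labeling.HasGoodSpectralEdges

/-! ### Isthmus-connected graphs -/

/-- The data `(A, I, B)` of an isthmus graph: graphs `A` and `B` with `a` and `b` vertices, each
connected or empty, and a path `I` with `m` vertices. -/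
structure IsthmusGraph where
  a : ℕ
  m : ℕ
  b : ℕ
  A : SimpleGraph (Fin a)
  B : SimpleGraph (Fin b)
  preconnected_A : A.Preconnected
  preconnected_B : B.Preconnected

namespace IsthmusGraph

/-- Vertices of the isthmus graph: those of `A`, of the path `I`, and of `B`. -/
abbrev Vert (G : IsthmusGraph) : Type := Fin G.a ⊕ Fin G.m ⊕ Fin G.b

/-- The numbering of the vertices by the integers from `1 - a` to `m + b`: first those of `A`, from
`1 - a` to `0`, then those of `I`, from `1` to `m`, then those of `B`, from `m + 1` to `m + b`. -/
def idx (G : IsthmusGraph) : G.Vert → ℤ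
  | .inl i => 1 - (G.a : ℤ) + (i : ℤ)
  | .inr (.inl i) => 1 + (i : ℤ)
  | .inr (.inr i) => (G.m : ℤ) + 1 + (i : ℤ)

/-- Edges of `A`, `I` and `B`, with the two cut edges `(v_0, v_1)` and `(v_m, v_{m+1})` (present when
their ends are), each in at least one of its two directions. -/
def edgeRel (G : IsthmusGraph) : G.Vert → G.Vert → Prop
  | .inl i, .inl j => G.A.Adj i j
  | .inr (.inl i), .inr (.inl j) => (i : ℕ) + 1 = j
  | .inr (.inr i), .inr (.inr j) => G.B.Adj i j
  | .inl i, .inr (.inl j) => (i : ℕ) + 1 = G.a ∧ (j : ℕ) = 0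
  | .inr (.inl i), .inr (.inr j) => (i : ℕ) + 1 = G.m ∧ (j : ℕ) = 0
  | _, _ => False

/-- The isthmus graph. -/
def graph (G : IsthmusGraph) : SimpleGraph G.Vert := SimpleGraph.fromRel G.edgeRel

/-- The isthmus vertex `v_{i+1}` as a vertex of the isthmus graph (`i` counts from `0`). -/
def isthmusVert (G : IsthmusGraph) (i : Fin G.m) : G.Vert := .inr (.inl i)

/-- Adjacency in the isthmus-connected graph: the edges of `ℤ^d × G` together with the edges between
`(α, f j)` and `(α + e_j, f j)`. -/
def periodicAdj (G : IsthmusGraph) {d : ℕ} (f : Fin d → Fin G.m)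
    (p q : (Fin d → ℤ) × G.Vert) : Prop :=
  (p.1 = q.1 ∧ G.graph.Adj p.2 q.2) ∨
    ∃ j, p.2 = G.isthmusVert (f j) ∧ q.2 = G.isthmusVert (f j) ∧
      (q.1 = p.1 + Pi.single j 1 ∨ p.1 = q.1 + Pi.single j 1)

/-- The `ℤ^d`-periodic isthmus-connected graph of the isthmus graph `G` and the function `f`. -/
def periodicGraph (G : IsthmusGraph) {d : ℕ} (f : Fin d → Fin G.m) :
    PeriodicGraph d G.Vert where
  graph :=
    { Adj := G.periodicAdj f
      symm := ⟨by
        rintro p q (⟨h1, h2⟩ | ⟨j, h1, h2, h3⟩)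
        · exact Or.inl ⟨h1.symm, h2.symm⟩
        · exact Or.inr ⟨j, h2, h1, h3.symm⟩⟩
      loopless := ⟨by
        rintro p (⟨_, h2⟩ | ⟨j, _, _, h3⟩)
        · exact G.graph.loopless.irrefl _ h2
        · have h4 : p.1 = p.1 + Pi.single j 1 := h3.elim id id
          have h5 := congrFun h4 j
          simp at h5⟩ }
  periodic := by
    rintro c p q (⟨h1, h2⟩ | ⟨j, h1, h2, h3⟩)
    · exact Or.inl ⟨by simp [shiftVert, h1], h2⟩
    · refine Or.inr ⟨j, h1, h2, ?_⟩
      rcases h3 with h3 | h3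
      · left; simp [shiftVert, h3, add_assoc]
      · right; simp [shiftVert, h3, add_assoc]
  cocompact := by
    intro v u
    refine Set.Finite.subset (((Set.finite_singleton (0 : Fin d → ℤ)).union
      (Set.finite_range fun j : Fin d => (Pi.single j 1 : Fin d → ℤ))).union
      (Set.finite_range fun j : Fin d => (-Pi.single j 1 : Fin d → ℤ))) ?_
    rintro c (⟨h1, _⟩ | ⟨j, _, _, h3 | h3⟩)
    · exact Or.inl (Or.inl h1.symm)
    · exact Or.inl (Or.inr ⟨j, by simpa using h3.symm⟩)
    · exact Or.inr ⟨j, (eq_neg_of_add_eq_zero_left h3.symm).symm⟩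

variable {G : IsthmusGraph} {d : ℕ} {f : Fin d → Fin G.m}

/-- `P_s(z, λ)`: the principal minor of `H(z) - λ` on the vertices of index less than `s`. -/
def minorP (L : Labeling (G.periodicGraph f)) (s : ℤ) (p : (Fin d → ℂ) × ℂ) : ℂ :=
  ((L.charMat p).submatrix (Subtype.val : {v : G.Vert // G.idx v < s} → G.Vert)
    (Subtype.val : {v : G.Vert // G.idx v < s} → G.Vert)).det

/-- `Q_s(z, λ)`: the principal minor of `H(z) - λ` on the vertices of index greater than `s`. -/
def minorQ (L : Labeling (G.periodicGraph f)) (s : ℤ) (p : (Fin d → ℂ) × ℂ) : ℂ :=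
  ((L.charMat p).submatrix (Subtype.val : {v : G.Vert // s < G.idx v} → G.Vert)
    (Subtype.val : {v : G.Vert // s < G.idx v} → G.Vert)).det

/-- Generic parameters on an isthmus-connected graph: no edge weight vanishes and, for every corner
point `x` and all `1 ≤ r ≤ s ≤ m`, no two of `P_r(x, λ)`, `Q_s(x, λ)`, `D(x, λ)` have a common root,
as polynomials in `λ`. -/
def IsGeneric (L : Labeling (G.periodicGraph f)) : Prop :=
  (∀ e, L.E e ≠ 0) ∧
    ∀ x : Fin d → ℂ, IsCornerPoint x → ∀ r s : ℤ, 1 ≤ r → r ≤ s → s ≤ G.m → ∀ t : ℂ,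
      ¬ (minorP L r (x, t) = 0 ∧ minorQ L s (x, t) = 0) ∧
      ¬ (minorP L r (x, t) = 0 ∧ L.dispersion (x, t) = 0) ∧
      ¬ (minorQ L s (x, t) = 0 ∧ L.dispersion (x, t) = 0)

end IsthmusGraph

end

noncomputable section

/-! ### Kernels of symmetric matrices and of their principal submatrices -/

section Kernel

variable {W K : Type} [Fintype W] [DecidableEq W] [Field K]

/-! The variables `z j` enter `H(z)` only through terms `h j * (z j + (z j)⁻¹)` on the diagonal, at
the isthmus vertices `f j`. Hence `D` is affine in each `y j = z j + (z j)⁻¹`, and `∂D/∂z j` is `h j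
* (1 - (z j)⁻²)` times the principal minor omitting `f j` (`critEqn_some`). At a critical point
every `j` has `z j = ±1` or a vanishing minor.

To exclude non-corner critical points, let `s` and `r` be the extreme positions of the `f j` with `z
j ≠ ±1`, and let `x` be the corner point obtained by setting those `z j` to `1`. If `D` and the
minor at position `s` vanish, then either the block left of `s` is singular, or a kernel vector
vanishes at all positions `≤ r` (`exists_left_or_right_kernel`). Such vectors do not see the change
from `z` to `x`. So `P_s(x) = 0`, or `Q_r(x) = D(x) = 0`; genericity leaves the former. By symmetry
`Q_r(x) = 0`, and `P_s`, `Q_r` then have a common root, a contradiction.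

At a corner point genericity also says that no eigenvector vanishes at an isthmus vertex. So the
eigenvalue is simple, all the minors are nonzero, and the Jacobian is diagonal with nonzero entries.
An extremum of a band gives a critical point, even where bands touch, because a double eigenvalue
kills every principal minor omitting one vertex. Hence extrema lie over the finitely many corner
points; there the band is a smooth function of `y`, and its Hessian is diagonal and invertible.

Genericity is the nonvanishing of finitely many edge weights and resultants, so it suffices to find,
for each resultant, one potential with edge weights `1` at which it is nonzero. For `P_r` and `Q_s`,
shift the potential right of `s` by a constant. For `D` with `P_r` or `Q_s`, use a potential none of
whose eigenvectors vanishes at the given isthmus vertex, built by adding one vertex at a time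
(`IsObservableOn.exists_insert`). -/

theorem Matrix.det_add_diagonal_single {R : Type} [CommRing R] (M : Matrix W W R) (s : W) (c : R) :
    (M + Matrix.diagonal (Pi.single s c)).det = M.det + c * M.adjugate s s := by
  have h : M + Matrix.diagonal (Pi.single s c)
      = M.updateRow s (M s + c • (Pi.single s 1 : W → R)) := by
    ext i j
    rcases eq_or_ne i s with rfl | hi
    · rcases eq_or_ne i j with rfl | hj
      · simp
      · simp [hj, hj.symm]
    · rcases eq_or_ne i j with rfl | hj
      · simp [hi]
      · simp [hi, hj]
  rw [h, Matrix.det_updateRow_add, Matrix.det_updateRow_smul, Matrix.updateRow_eq_self,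
    Matrix.adjugate_apply]

theorem Matrix.adjugate_add_diagonal_single {R : Type} [CommRing R] (M : Matrix W W R) (s : W)
    (c : R) : (M + Matrix.diagonal (Pi.single s c)).adjugate s s = M.adjugate s s := by
  rw [Matrix.adjugate_apply, Matrix.adjugate_apply]
  congr 1
  ext i j
  rcases eq_or_ne i s with rfl | hi
  · simp
  · rcases eq_or_ne i j with rfl | hj
    · simp [hi]
    · simp [hi, hj]

/-- The minor is the determinant of `M` with row `s` replaced by the unit vector at `s`; the vectors
`φ` are the kernel of that matrix. -/
theorem Matrix.adjugate_self_eq_zero_iff (M : Matrix W W K) (s : W) :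
    M.adjugate s s = 0 ↔ ∃ φ : W → K, φ ≠ 0 ∧ φ s = 0 ∧ ∀ v, v ≠ s → (M.mulVec φ) v = 0 := by
  rw [Matrix.adjugate_apply, ← Matrix.exists_mulVec_eq_zero_iff]
  refine exists_congr fun φ => and_congr_right fun _ => ⟨fun h => ⟨?_, fun v hv => ?_⟩, fun h => ?_⟩
  · simpa [Matrix.mulVec] using congrFun h s
  · simpa [Matrix.mulVec, hv] using congrFun h v
  · ext v
    rcases eq_or_ne v s with rfl | hv
    · simp [Matrix.mulVec, h.1]
    · simpa [Matrix.mulVec, hv] using h.2 v hv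

theorem Matrix.submatrix_val_mulVec (M : Matrix W W K) (p : W → Prop) [Fintype {v // p v}]
    {φ : W → K} (hφ : ∀ v, ¬ p v → φ v = 0) (v : {v // p v}) :
    ((M.submatrix (Subtype.val : {v // p v} → W) (Subtype.val : {v // p v} → W)).mulVec
      (fun u => φ u)) v = (M.mulVec φ) v := by
  classical
  simp only [Matrix.mulVec, dotProduct, Matrix.submatrix_apply]
  rw [← Finset.sum_subtype (Finset.univ.filter p) (by simp) fun u => M v u * φ u,
    Finset.sum_filter]
  refine Finset.sum_congr rfl fun u _ => ?_
  split_ifs with hu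
  · rfl
  · rw [hφ u hu, mul_zero]

theorem Matrix.det_submatrix_val_eq_zero_iff (M : Matrix W W K) (p : W → Prop) [DecidablePred p] :
    (M.submatrix (Subtype.val : {v // p v} → W) (Subtype.val : {v // p v} → W)).det = 0 ↔
      ∃ φ : W → K, φ ≠ 0 ∧ (∀ v, ¬ p v → φ v = 0) ∧ ∀ v, p v → (M.mulVec φ) v = 0 := by
  rw [← Matrix.exists_mulVec_eq_zero_iff]
  constructor
  · rintro ⟨φ, hφ0, hφ⟩
    have hval : (fun u : {v // p v} => (fun v => if h : p v then φ ⟨v, h⟩ else 0) u.1) = φ := by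
      ext u
      simp [u.2]
    refine ⟨fun v => if h : p v then φ ⟨v, h⟩ else 0, fun h0 => hφ0 ?_, fun v hv => dif_neg hv,
      fun v hv => ?_⟩
    · rw [← hval, h0]
      rfl
    · rw [← M.submatrix_val_mulVec p (fun v hv => dif_neg hv) ⟨v, hv⟩, hval, hφ]
      rfl
  · rintro ⟨φ, hφ0, hφ, hM⟩
    refine ⟨fun u => φ u, fun h0 => hφ0 ?_, ?_⟩
    · ext v
      by_cases hv : p v
      · exact congrFun h0 ⟨v, hv⟩
      · exact hφ v hv
    · ext v
      rw [M.submatrix_val_mulVec p hφ, hM v v.2]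
      rfl

theorem Matrix.IsSymm.dotProduct_mulVec_comm {M : Matrix W W K} (hM : M.IsSymm) (φ ψ : W → K) :
    φ ⬝ᵥ M.mulVec ψ = M.mulVec φ ⬝ᵥ ψ := by
  rw [Matrix.dotProduct_mulVec, ← Matrix.mulVec_transpose, hM.eq]

end Kernel

/-! ### Vectors on a graph with an isthmus -/

section Isthmus

variable {W K : Type} [Fintype W] [DecidableEq W] [Field K]

/-- A symmetric matrix whose off-diagonal support is that of a graph in which the vertices of
positions `1, …, m` form a path separating the nonpositive positions from those beyond `m`. -/
structure IsIsthmusMatrix (pos : W → ℤ) (m : ℤ) (M : Matrix W W K) : Prop where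
  symm : M.IsSymm
  inj : ∀ u v, 1 ≤ pos u → pos u ≤ m → pos u = pos v → u = v
  surj : ∀ i, 1 ≤ i → i ≤ m → ∃ v, pos v = i
  cut : ∀ u v i, 1 ≤ i → i ≤ m → pos u < i → i < pos v → M u v = 0
  path : ∀ u v, 1 ≤ pos u → pos u + 1 = pos v → pos v ≤ m → M u v ≠ 0

namespace IsIsthmusMatrix

variable {pos : W → ℤ} {m : ℤ} {M : Matrix W W K}

/-- Statements about the right-hand side follow from those about the left-hand side by this
symmetry. -/
theorem reflect (h : IsIsthmusMatrix pos m M) : IsIsthmusMatrix (fun v => m + 1 - pos v) m M where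
  symm := h.symm
  inj u v h1 h2 h3 := h.inj u v (by omega) (by omega) (by omega)
  surj i h1 h2 := by
    obtain ⟨v, hv⟩ := h.surj (m + 1 - i) (by omega) (by omega)
    exact ⟨v, by omega⟩
  cut u v i h1 h2 h3 h4 := by
    rw [← h.symm.apply]
    exact h.cut v u (m + 1 - i) (by omega) (by omega) (by omega) (by omega)
  path u v h1 h2 h3 := by
    rw [← h.symm.apply]
    exact h.path v u (by omega) (by omega) (by omega)

/-- Vanishing propagates along the path: in the row at position `t`, the only entry that can meet a
nonzero value of `ψ` is the path edge to position `t + 1`. -/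
theorem kernel_vanishes (h : IsIsthmusMatrix pos m M) {ψ : W → K} (hψ : M.mulVec ψ = 0) {s t : ℤ}
    (hs : 1 ≤ s) (hst : s ≤ t) (htm : t ≤ m) (h0 : ∀ v, pos v ≤ s → ψ v = 0) :
    ∀ v, pos v ≤ t → ψ v = 0 := by
  induction t, hst using Int.leInduction with
  | base => exact h0
  | succ t hst ih =>
    have ih := ih (by omega)
    intro v hv
    rcases lt_or_eq_of_le hv with hv | hv
    · exact ih v (by omega)
    obtain ⟨u, hu⟩ := h.surj t (by omega) (by omega)
    have h1 : M u v * ψ v = 0 := by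
      have h2 := congrFun hψ u
      rw [Matrix.mulVec, dotProduct, Finset.sum_eq_single v] at h2
      · exact h2
      · intro w _ hw
        rcases lt_trichotomy (pos w) (t + 1) with h3 | h3 | h3
        · rw [ih w (by omega), mul_zero]
        · exact absurd (h.inj v w (by omega) (by omega) (by omega)).symm hw
        · rw [h.cut u w (t + 1) (by omega) (by omega) (by omega) h3, zero_mul]
      · simp
    exact (mul_eq_zero.1 h1).resolve_left (h.path u v (by omega) (by omega) (by omega))

/-- Truncate `φ` to the positions left of `c`. No row left of `c` reaches beyond `c`, and `φ c = 0`,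
so these rows do not notice the truncation. -/
theorem exists_left_kernel (h : IsIsthmusMatrix pos m M) {c : W} (hc : 1 ≤ pos c) (hcm : pos c ≤ m)
    {φ : W → K} (hφc : φ c = 0) (hφ : ∀ v, pos v < pos c → (M.mulVec φ) v = 0) {v : W}
    (hv : pos v ≤ pos c) (hvφ : φ v ≠ 0) :
    ∃ χ : W → K, χ ≠ 0 ∧ (∀ v, ¬ pos v < pos c → χ v = 0) ∧
      ∀ v, pos v < pos c → (M.mulVec χ) v = 0 := by
  refine ⟨fun u => if pos u < pos c then φ u else 0, fun h0 => ?_, fun u hu => if_neg hu,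
    fun u hu => ?_⟩
  · rcases lt_or_eq_of_le hv with hv | hv
    · exact hvφ (by simpa [hv] using congrFun h0 v)
    · rw [← h.inj c v hc hcm hv.symm] at hvφ
      exact hvφ hφc
  · refine Eq.trans ?_ (hφ u hu)
    simp only [Matrix.mulVec, dotProduct]
    refine Finset.sum_congr rfl fun w _ => ?_
    rcases lt_trichotomy (pos w) (pos c) with h3 | h3 | h3
    · rw [if_pos h3]
    · rw [← h.inj c w hc hcm h3.symm, hφc, ite_self]
    · rw [h.cut u w (pos c) hc hcm hu h3, zero_mul, zero_mul]

/-- The vanishing minor gives `φ` with `φ c = 0` and `M φ` supported at `c`; the vanishing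
determinant gives a kernel vector `ψ`. Symmetry of `M` forces `(M φ) c * ψ c = 0`, so one of the two
is a kernel vector vanishing at `c`. Without a left kernel it vanishes up to `c`, hence up to `t` by
propagation along the path. -/
theorem exists_left_or_right_kernel (h : IsIsthmusMatrix pos m M) (hdet : M.det = 0) {c : W}
    (hc : 1 ≤ pos c) (hadj : M.adjugate c c = 0) {t : ℤ} (hct : pos c ≤ t) (htm : t ≤ m) :
    (∃ χ : W → K, χ ≠ 0 ∧ (∀ v, ¬ pos v < pos c → χ v = 0) ∧
      ∀ v, pos v < pos c → (M.mulVec χ) v = 0) ∨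
    ∃ ψ : W → K, ψ ≠ 0 ∧ M.mulVec ψ = 0 ∧ ∀ v, pos v ≤ t → ψ v = 0 := by
  refine or_iff_not_imp_left.2 fun hL => ?_
  have split : ∀ φ : W → K, φ c = 0 → (∀ v, v ≠ c → (M.mulVec φ) v = 0) →
      ∀ v, pos v ≤ pos c → φ v = 0 := by
    intro φ hφc hφ
    by_contra! hcon
    obtain ⟨v, hv, hvφ⟩ := hcon
    exact hL (h.exists_left_kernel hc (hct.trans htm) hφc
      (fun v hv => hφ v (by rintro rfl; omega)) hv hvφ)
  suffices ∃ ψ : W → K, ψ ≠ 0 ∧ M.mulVec ψ = 0 ∧ ψ c = 0 by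
    obtain ⟨ψ, h1, h2, h3⟩ := this
    exact ⟨ψ, h1, h2, h.kernel_vanishes h2 hc hct htm
      (split ψ h3 fun v _ => congrFun h2 v)⟩
  obtain ⟨φ, hφ0, hφc, hφ⟩ := (M.adjugate_self_eq_zero_iff c).1 hadj
  obtain ⟨ψ, hψ0, hψ⟩ := Matrix.exists_mulVec_eq_zero_iff.2 hdet
  have h4 : (M.mulVec φ) c * ψ c = 0 := by
    have h5 := h.symm.dotProduct_mulVec_comm φ ψ
    rw [hψ, dotProduct_zero, dotProduct, Finset.sum_eq_single c] at h5
    · exact h5.symm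
    · intro v _ hv
      rw [hφ v hv, zero_mul]
    · simp
  rcases mul_eq_zero.1 h4 with h5 | h5
  · refine ⟨φ, hφ0, ?_, hφc⟩
    ext v
    rcases eq_or_ne v c with rfl | hv
    · exact h5
    · exact hφ v hv
  · exact ⟨ψ, hψ0, hψ, h5⟩

end IsIsthmusMatrix

end Isthmus

/-! ### Families of matrices depending on parameters along the diagonal -/

section Family

variable {W R : Type} [Fintype W] [DecidableEq W] [CommRing R] {d : ℕ}

/-- The matrix `N` with `∑ h j * y j` (over the `j` with `g j = v`) added to the diagonal entry at
each `v`. -/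
def diagFamily (N : Matrix W W R) (g : Fin d → W) (h y : Fin d → R) : Matrix W W R :=
  N + Matrix.diagonal fun v => ∑ j, if g j = v then h j * y j else 0

theorem diagFamily_update (N : Matrix W W R) (g : Fin d → W) (h y : Fin d → R) (j : Fin d)
    (t : R) : diagFamily N g h (Function.update y j t)
      = diagFamily N g h y + Matrix.diagonal (Pi.single (g j) (h j * (t - y j))) := by
  rw [diagFamily, diagFamily, add_assoc, Matrix.diagonal_add]
  congr 2
  ext v
  have h1 : (Pi.single (g j) (h j * (t - y j)) : W → R) v
      = ∑ i, if i = j then (if g i = v then h i * (t - y i) else 0) else 0 := by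
    rw [Finset.sum_ite_eq' Finset.univ j, if_pos (Finset.mem_univ _), Pi.single_apply]
    simp only [eq_comm]
  rw [h1, ← Finset.sum_add_distrib]
  refine Finset.sum_congr rfl fun i _ => ?_
  rcases eq_or_ne i j with rfl | hi
  · by_cases hv : g i = v <;> simp [hv, mul_sub]
  · simp [hi]

theorem diagFamily_map {S : Type} [CommRing S] (φ : R →+* S) (N : Matrix W W R) (g : Fin d → W)
    (h y : Fin d → R) :
    (diagFamily N g h y).map φ = diagFamily (N.map φ) g (φ ∘ h) (φ ∘ y) := by
  ext u v
  rcases eq_or_ne u v with rfl | huv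
  · simp [diagFamily, apply_ite φ]
  · simp [diagFamily, huv]

theorem diagFamily_isSymm {N : Matrix W W R} (hN : N.IsSymm) (g : Fin d → W) (h y : Fin d → R) :
    (diagFamily N g h y).IsSymm :=
  hN.add (Matrix.isSymm_diagonal _)

/-- The characteristic determinant of the family. -/
def famDet (N : Matrix W W R) (g : Fin d → W) (h y : Fin d → R) (t : R) : R :=
  (diagFamily N g h y - Matrix.scalar W t).det

/-- The principal minor of the characteristic matrix of the family that omits `s`. -/
def famMinor (N : Matrix W W R) (g : Fin d → W) (h y : Fin d → R) (t : R) (s : W) : R :=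
  (diagFamily N g h y - Matrix.scalar W t).adjugate s s

theorem famDet_update (N : Matrix W W R) (g : Fin d → W) (h y : Fin d → R) (t : R) (j : Fin d)
    (r : R) : famDet N g h (Function.update y j r) t
      = famDet N g h y t + h j * (r - y j) * famMinor N g h y t (g j) := by
  rw [famDet, diagFamily_update, add_sub_right_comm, Matrix.det_add_diagonal_single]
  rfl

theorem famMinor_update (N : Matrix W W R) (g : Fin d → W) (h y : Fin d → R) (t : R) (j : Fin d)
    (r : R) : famMinor N g h (Function.update y j r) t (g j) = famMinor N g h y t (g j) := by
  rw [famMinor, diagFamily_update, add_sub_right_comm, Matrix.adjugate_add_diagonal_single]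
  rfl

theorem famDet_map {S : Type} [CommRing S] (φ : R →+* S) (N : Matrix W W R) (g : Fin d → W)
    (h y : Fin d → R) (t : R) :
    φ (famDet N g h y t) = famDet (N.map φ) g (φ ∘ h) (φ ∘ y) (φ t) := by
  rw [famDet, RingHom.map_det, famDet, ← diagFamily_map]
  congr 1
  ext u v
  rcases eq_or_ne u v with rfl | huv
  · simp
  · simp [huv]

theorem famMinor_map {S : Type} [CommRing S] (φ : R →+* S) (N : Matrix W W R) (g : Fin d → W)
    (h y : Fin d → R) (t : R) (s : W) :
    φ (famMinor N g h y t s) = famMinor (N.map φ) g (φ ∘ h) (φ ∘ y) (φ t) s := by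
  have h1 := congrFun (congrFun (φ.map_adjugate (diagFamily N g h y - Matrix.scalar W t)) s) s
  rw [RingHom.mapMatrix_apply, Matrix.map_apply] at h1
  rw [famMinor, h1, famMinor, ← diagFamily_map]
  congr 2
  ext u v
  rcases eq_or_ne u v with rfl | huv
  · simp
  · simp [huv]

end Family

/-! ### Simple eigenvalues of Hermitian matrices -/

section Hermitian

variable {W 𝕜 : Type} [Fintype W] [DecidableEq W] [RCLike 𝕜] {A : Matrix W W 𝕜}

theorem Matrix.det_sub_scalar_eq_charpoly {R : Type} [CommRing R] (A : Matrix W W R) (t : R) :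
    (A - Matrix.scalar W t).det = (-1) ^ Fintype.card W * A.charpoly.eval t := by
  rw [Matrix.eval_charpoly, ← Matrix.det_neg, neg_sub]

theorem Matrix.IsHermitian.det_sub_scalar (hA : A.IsHermitian) (t : 𝕜) :
    (A - Matrix.scalar W t).det = ∏ i, ((hA.eigenvalues i : 𝕜) - t) := by
  rw [A.det_sub_scalar_eq_charpoly, hA.charpoly_eq, Polynomial.eval_prod, Fintype.card,
    ← Finset.prod_const, ← Finset.prod_mul_distrib]
  simp

theorem Matrix.IsHermitian.det_sub_scalar_eq_prod_eigenvalues₀ (hA : A.IsHermitian) (t : 𝕜) :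
    (A - Matrix.scalar W t).det = ∏ k, ((hA.eigenvalues₀ k : 𝕜) - t) := by
  rw [hA.det_sub_scalar]
  exact Fintype.prod_equiv (Fintype.equivOfCardEq (Fintype.card_fin _)).symm _ _ fun i => rfl

/-- At a root, only the term of the product rule that differentiates the vanishing factor survives.
-/
theorem hasDerivAt_prod_sub {ι : Type} [Fintype ι] [DecidableEq ι] (μ : ι → 𝕜) (i : ι) :
    HasDerivAt (fun t => ∏ k, (μ k - t)) (-∏ k ∈ Finset.univ.erase i, (μ k - μ i)) (μ i) := by
  have h := HasDerivAt.finsetProd (u := Finset.univ) (f := fun k t => μ k - t) (x := μ i)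
    (f' := fun _ => -1) fun k _ => by simpa using (hasDerivAt_id (μ i)).const_sub (μ k)
  rw [Finset.sum_eq_single i] at h
  · simpa [Finset.prod_fn] using h
  · intro k _ hk
    rw [Finset.prod_eq_zero (i := i) (by simp [hk.symm]) (by simp), zero_smul]
  · simp

/-- At a double eigenvalue there is an eigenvector that vanishes at a given place. -/
theorem Matrix.IsHermitian.exists_eigenvector_apply_eq_zero (hA : A.IsHermitian) {i j : W}
    (hij : i ≠ j) (he : hA.eigenvalues i = hA.eigenvalues j) (s : W) :
    ∃ φ : W → 𝕜, φ ≠ 0 ∧ φ s = 0 ∧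
      (A - Matrix.scalar W (hA.eigenvalues i : 𝕜)).mulVec φ = 0 := by
  have hk : ∀ k, (A - Matrix.scalar W (hA.eigenvalues k : 𝕜)).mulVec (hA.eigenvectorBasis k) = 0 := by
    intro k
    rw [Matrix.sub_mulVec, hA.mulVec_eigenvectorBasis]
    ext v
    simp [RCLike.real_smul_eq_coe_mul]
  have hne : ∀ k, ((hA.eigenvectorBasis k : EuclideanSpace 𝕜 W) : W → 𝕜) ≠ 0 := fun k h0 =>
    hA.eigenvectorBasis.orthonormal.ne_zero k ((WithLp.ofLp_eq_zero 2).1 h0)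
  -- Otherwise eliminate the entry at `s` between the two eigenvectors. The combination is nonzero
  -- because its coefficient along the `i`-th one is the nonzero entry of the `j`-th one at `s`.
  by_cases h0 : hA.eigenvectorBasis j s = 0
  · exact ⟨_, hne j, h0, by rw [he]; exact hk j⟩
  refine ⟨hA.eigenvectorBasis j s • ⇑(hA.eigenvectorBasis i)
    - hA.eigenvectorBasis i s • ⇑(hA.eigenvectorBasis j), fun h1 => h0 ?_, by simp [mul_comm], ?_⟩
  · have h2 : hA.eigenvectorBasis j s • hA.eigenvectorBasis i
        - hA.eigenvectorBasis i s • hA.eigenvectorBasis j = 0 :=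
      (WithLp.ofLp_eq_zero 2).1 (by simpa using h1)
    have h3 := congrArg (inner 𝕜 (hA.eigenvectorBasis i)) h2
    simpa [inner_sub_right, inner_smul_right, orthonormal_iff_ite.1 hA.eigenvectorBasis.orthonormal,
      hij] using h3
  · rw [Matrix.mulVec_sub, Matrix.mulVec_smul, Matrix.mulVec_smul, hk i]
    rw [he, hk j]
    simp

/-- Where the characteristic determinant has a double root, there is an eigenvector that vanishes
at a given place. -/
theorem Matrix.IsHermitian.exists_eigenvector_of_deriv_eq_zero (hA : A.IsHermitian) {t : 𝕜}
    (h0 : (A - Matrix.scalar W t).det = 0)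
    (h1 : deriv (fun t => (A - Matrix.scalar W t).det) t = 0) (s : W) :
    ∃ φ : W → 𝕜, φ ≠ 0 ∧ φ s = 0 ∧ (A - Matrix.scalar W t).mulVec φ = 0 := by
  rw [hA.det_sub_scalar, Finset.prod_eq_zero_iff] at h0
  obtain ⟨i, -, hi⟩ := h0
  obtain rfl : (hA.eigenvalues i : 𝕜) = t := sub_eq_zero.1 hi
  simp only [hA.det_sub_scalar] at h1
  rw [(hasDerivAt_prod_sub (fun k => (hA.eigenvalues k : 𝕜)) i).deriv, neg_eq_zero,
    Finset.prod_eq_zero_iff] at h1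
  obtain ⟨j, hj, hji⟩ := h1
  exact hA.exists_eigenvector_apply_eq_zero (Finset.ne_of_mem_erase hj).symm
    (RCLike.ofReal_injective (sub_eq_zero.1 hji)).symm s

end Hermitian

/-- If the minor vanished, some `φ ≠ 0` with `φ s = 0` would have `M φ` supported at `s`. Pairing
with a kernel vector `ψ`, where `ψ s ≠ 0`, gives `M φ = 0`, against `hs`. -/
theorem Matrix.adjugate_ne_zero_of_symm {W K : Type} [Fintype W] [DecidableEq W] [Field K]
    {M : Matrix W W K} (hM : M.IsSymm) (hdet : M.det = 0) {s : W}
    (hs : ∀ φ : W → K, M.mulVec φ = 0 → φ s = 0 → φ = 0) : M.adjugate s s ≠ 0 := by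
  intro hadj
  obtain ⟨φ, hφ0, hφs, hφ⟩ := (M.adjugate_self_eq_zero_iff s).1 hadj
  obtain ⟨ψ, hψ0, hψ⟩ := Matrix.exists_mulVec_eq_zero_iff.2 hdet
  have h5 := hM.dotProduct_mulVec_comm φ ψ
  rw [hψ, dotProduct_zero, dotProduct, Finset.sum_eq_single s] at h5
  · have h6 := (mul_eq_zero.1 h5.symm).resolve_right fun h => hψ0 (hs ψ hψ h)
    refine hφ0 (hs φ ?_ hφs)
    ext v
    rcases eq_or_ne v s with rfl | hv
    · exact h6
    · exact hφ v hv
  · intro v _ hv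
    rw [hφ v hv, zero_mul]
  · simp

theorem diagFamily_ofReal_isHermitian {W : Type} [Fintype W] [DecidableEq W] {d : ℕ}
    {N : Matrix W W ℝ} (hN : N.IsSymm) (g : Fin d → W) (h y : Fin d → ℝ) :
    ((diagFamily N g h y).map Complex.ofRealHom).IsHermitian := by
  ext u v
  simp [(diagFamily_isSymm hN g h y).apply]

theorem IsCornerPoint.ne_zero {d : ℕ} {x : Fin d → ℂ} (hx : IsCornerPoint x) (j : Fin d) :
    x j ≠ 0 := by
  rcases hx j with h | h <;> simp [h]

theorem IsCornerPoint.sq_eq_one {d : ℕ} {x : Fin d → ℂ} (hx : IsCornerPoint x) (j : Fin d) :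
    x j ^ 2 = 1 := by
  rcases hx j with h | h <;> simp [h]

theorem IsCornerPoint.add_inv {d : ℕ} {x : Fin d → ℂ} (hx : IsCornerPoint x) :
    (fun j => x j + (x j)⁻¹) = Complex.ofRealHom ∘ fun j => 2 * (x j).re := by
  ext j
  rcases hx j with h | h <;> norm_num [h]

/-! ### Critical points of dispersion polynomials that are affine in each `z j + (z j)⁻¹` -/

namespace Labeling

variable {d : ℕ} {W : Type} [DecidableEq W] {Γ : PeriodicGraph d W}

/-- The Floquet matrix depends on `z` only through the diagonal terms `h j * (z j + (z j)⁻¹)`. -/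
def HasDiagForm (L : Labeling Γ) (N : Matrix W W ℝ) (g : Fin d → W) (h : Fin d → ℝ) : Prop :=
  ∀ z, L.floquet z = diagFamily (N.map Complex.ofRealHom) g (Complex.ofRealHom ∘ h)
    fun j => z j + (z j)⁻¹

namespace HasDiagForm

variable [Fintype W] {L : Labeling Γ} {N : Matrix W W ℝ} {g : Fin d → W} {h : Fin d → ℝ}

theorem dispersion_eq (hL : L.HasDiagForm N g h) (p : (Fin d → ℂ) × ℂ) :
    L.dispersion p = famDet (N.map Complex.ofRealHom) g (Complex.ofRealHom ∘ h)
      (fun j => p.1 j + (p.1 j)⁻¹) p.2 := by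
  rw [dispersion, charMat, hL, famDet]

theorem adjugate_charMat (hL : L.HasDiagForm N g h) (p : (Fin d → ℂ) × ℂ) (s : W) :
    (L.charMat p).adjugate s s = famMinor (N.map Complex.ofRealHom) g (Complex.ofRealHom ∘ h)
      (fun j => p.1 j + (p.1 j)⁻¹) p.2 s := by
  rw [charMat, hL, famMinor]

theorem charMat_isSymm (hL : L.HasDiagForm N g h) (hN : N.IsSymm) (p : (Fin d → ℂ) × ℂ) :
    (L.charMat p).IsSymm := by
  rw [charMat, hL]
  refine (diagFamily_isSymm ?_ _ _ _).sub (Matrix.isSymm_diagonal _)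
  ext u v
  simp [hN.apply]

theorem update_add_inv (z : Fin d → ℂ) (j : Fin d) (t : ℂ) :
    (fun i => Function.update z j t i + (Function.update z j t i)⁻¹)
      = Function.update (fun i => z i + (z i)⁻¹) j (t + t⁻¹) := by
  ext i
  rcases eq_or_ne i j with rfl | hi
  · simp
  · simp [hi]

theorem dispersion_update (hL : L.HasDiagForm N g h) (z : Fin d → ℂ) (t : ℂ) (j : Fin d) (r : ℂ) :
    L.dispersion (Function.update z j r, t) = L.dispersion (z, t)
      + h j * ((r + r⁻¹) - (z j + (z j)⁻¹)) * (L.charMat (z, t)).adjugate (g j) (g j) := by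
  rw [hL.dispersion_eq, hL.dispersion_eq, hL.adjugate_charMat]
  simp only [update_add_inv]
  rw [famDet_update]
  rfl

theorem adjugate_update (hL : L.HasDiagForm N g h) (z : Fin d → ℂ) (t : ℂ) (j : Fin d) (r : ℂ) :
    (L.charMat (Function.update z j r, t)).adjugate (g j) (g j)
      = (L.charMat (z, t)).adjugate (g j) (g j) := by
  rw [hL.adjugate_charMat, hL.adjugate_charMat]
  simp only [update_add_inv]
  rw [famMinor_update]

theorem critEqn_some (hL : L.HasDiagForm N g h) {p : (Fin d → ℂ) × ℂ} {j : Fin d}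
    (hj : p.1 j ≠ 0) : L.critEqn (some j) p
      = h j * (1 - (p.1 j ^ 2)⁻¹) * (L.charMat p).adjugate (g j) (g j) := by
  obtain ⟨z, t⟩ := p
  simp only [critEqn, pderivAt, hL.dispersion_update]
  refine HasDerivAt.deriv ?_
  have h1 := ((hasDerivAt_id (z j)).add (hasDerivAt_inv hj)).sub_const (z j + (z j)⁻¹)
  have h2 := ((h1.const_mul (h j : ℂ)).mul_const
    ((L.charMat (z, t)).adjugate (g j) (g j))).const_add (L.dispersion (z, t))
  convert! h2 using 1

theorem isCritical_iff (hL : L.HasDiagForm N g h) (hh : ∀ j, h j ≠ 0) (p : (Fin d → ℂ) × ℂ) :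
    L.IsCritical p ↔ (∀ i, p.1 i ≠ 0) ∧ L.dispersion p = 0 ∧
      ∀ j, (p.1 j = 1 ∨ p.1 j = -1) ∨ (L.charMat p).adjugate (g j) (g j) = 0 := by
  refine and_congr_right fun hz => ?_
  rw [Option.forall]
  refine and_congr_right fun _ => forall_congr' fun j => ?_
  have h1 : (h j : ℂ) ≠ 0 := by exact_mod_cast hh j
  rw [hL.critEqn_some (hz j), mul_eq_zero, mul_eq_zero, or_iff_right h1, sub_eq_zero,
    eq_comm (a := (1 : ℂ)), inv_eq_one, sq_eq_one_iff]

/-- The factor `1 - (z j)⁻²` of the `j`-th equation vanishes at a corner point and depends on `z j`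
alone, so the Jacobian is diagonal there. Its entry for `λ` is nonzero because the matrix is
Hermitian and a double eigenvalue would have an eigenvector vanishing at some `g j`. -/
theorem isNondegenerate (hL : L.HasDiagForm N g h) (hN : N.IsSymm) (hh : ∀ j, h j ≠ 0)
    (hd : 0 < d) {x : Fin d → ℂ} {t : ℂ} (hx : IsCornerPoint x) (h0 : L.dispersion (x, t) = 0)
    (hker : ∀ j, ∀ φ : W → ℂ, (L.charMat (x, t)).mulVec φ = 0 → φ (g j) = 0 → φ = 0) :
    L.IsNondegenerate (x, t) := by
  have hadj : ∀ j, (L.charMat (x, t)).adjugate (g j) (g j) ≠ 0 := fun j =>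
    Matrix.adjugate_ne_zero_of_symm (hL.charMat_isSymm hN _) h0 (hker j)
  have hlam : pderivAt none L.dispersion (x, t) ≠ 0 := by
    intro h1
    have hA := diagFamily_ofReal_isHermitian hN g h fun j => 2 * (x j).re
    rw [diagFamily_map, ← hx.add_inv, ← hL] at hA
    obtain ⟨φ, hφ, hφ0, hφk⟩ := hA.exists_eigenvector_of_deriv_eq_zero h0 h1 (g ⟨0, hd⟩)
    exact hφ (hker _ φ hφk hφ0)
  have hJ : L.critJacobian (x, t) = Matrix.diagonal fun r => match r with
      | none => pderivAt none L.dispersion (x, t)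
      | some j => h j * (2 * x j) * (L.charMat (x, t)).adjugate (g j) (g j) := by
    ext r c
    rcases r with _ | j
    · rcases c with _ | i
      · rfl
      · rw [Matrix.diagonal_apply_ne _ (by simp), critJacobian, Matrix.of_apply]
        have h1 := hL.critEqn_some (p := (x, t)) (hx.ne_zero i)
        refine h1.trans ?_
        simp [hx.sq_eq_one]
    · rcases c with _ | i
      · rw [Matrix.diagonal_apply_ne _ (by simp), critJacobian, Matrix.of_apply]
        have h1 : (fun r => L.critEqn (some j) (x, r)) = fun _ => 0 := by
          ext r
          rw [hL.critEqn_some (hx.ne_zero j)]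
          simp [hx.sq_eq_one]
        simp only [pderivAt, h1, deriv_const]
      · rw [critJacobian, Matrix.of_apply]
        simp only [pderivAt]
        rcases eq_or_ne i j with rfl | hij
        · rw [Matrix.diagonal_apply_eq]
          have h1 : (fun r => L.critEqn (some i) (Function.update x i r, t)) =ᶠ[𝓝 (x i)]
              fun r => h i * (1 - (r ^ 2)⁻¹) * (L.charMat (x, t)).adjugate (g i) (g i) := by
            filter_upwards [isOpen_ne.mem_nhds (hx.ne_zero i)] with r hr
            rw [hL.critEqn_some (by simpa using hr), hL.adjugate_update]
            simp
          rw [h1.deriv_eq]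
          refine HasDerivAt.deriv ?_
          have h2 := ((hasDerivAt_pow 2 (x i)).fun_inv (pow_ne_zero 2 (hx.ne_zero i))).const_sub 1
          have h3 := (h2.const_mul (h i : ℂ)).mul_const ((L.charMat (x, t)).adjugate (g i) (g i))
          convert! h3 using 1
          simp [hx.sq_eq_one]
        · rw [Matrix.diagonal_apply_ne _ (by simpa using hij.symm)]
          have h1 : (fun r => L.critEqn (some j) (Function.update x i r, t)) = fun _ => 0 := by
            ext r
            have h2 : Function.update x i r j = x j := Function.update_of_ne hij.symm _ _
            rw [hL.critEqn_some (by simpa [h2] using hx.ne_zero j)]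
            simp [h2, hx.sq_eq_one]
          rw [h1, deriv_const]
  rw [IsNondegenerate, hJ, Matrix.det_diagonal, Finset.prod_ne_zero_iff]
  rintro (_ | j) -
  · exact hlam
  · have h1 : (h j : ℂ) ≠ 0 := by exact_mod_cast hh j
    exact mul_ne_zero (mul_ne_zero h1 (mul_ne_zero two_ne_zero (hx.ne_zero j))) (hadj j)

end HasDiagForm

end Labeling

/-! ### Continuity of the ordered eigenvalues -/

section Continuity

/-- Both families list in decreasing order the roots of one monic polynomial. -/
theorem antitone_eq_of_prod_sub_eq {n : ℕ} {μ ν : Fin n → ℝ} (hμ : Antitone μ) (hν : Antitone ν)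
    (h : ∀ t : ℝ, ∏ k, (μ k - t) = ∏ k, (ν k - t)) : μ = ν := by
  have hroots : ∀ μ : Fin n → ℝ, (∏ k, (Polynomial.X - Polynomial.C (μ k))).roots
      = Multiset.map μ Finset.univ.val := fun μ => by
    rw [Polynomial.roots_prod _ _ (by simp [Finset.prod_ne_zero_iff, Polynomial.X_sub_C_ne_zero])]
    simp
  have hpoly : ∏ k, (Polynomial.X - Polynomial.C (μ k)) = ∏ k, (Polynomial.X - Polynomial.C (ν k)) := by
    refine Polynomial.funext fun t => ?_
    simp only [Polynomial.eval_prod, Polynomial.eval_sub, Polynomial.eval_X, Polynomial.eval_C]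
    have h1 := congrArg (fun r => (∏ _k : Fin n, (-1 : ℝ)) * r) (h t)
    simpa only [← Finset.prod_mul_distrib, neg_mul, one_mul, neg_sub] using h1
  have hm : Multiset.map μ Finset.univ.val = Multiset.map ν Finset.univ.val := by
    rw [← hroots, ← hroots, hpoly]
  rw [Fin.univ_val_map, Fin.univ_val_map, Multiset.coe_eq_coe] at hm
  refine List.ofFn_injective (hm.eq_of_sortedGE ?_ ?_)
  · exact hμ.sortedGE_ofFn
  · exact hν.sortedGE_ofFn

variable {W : Type} [Fintype W] [DecidableEq W] {X : Type} [TopologicalSpace X]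

/-- Compare the two sides of the eigenvalue equation at an entry of the eigenvector of maximal
modulus. -/
theorem Matrix.IsHermitian.abs_eigenvalues_le {A : Matrix W W ℂ} (hA : A.IsHermitian) (i : W) :
    |hA.eigenvalues i| ≤ ∑ u, ∑ v, ‖A u v‖ := by
  have hdet : (A - Matrix.scalar W (hA.eigenvalues i : ℂ)).det = 0 := by
    rw [hA.det_sub_scalar]
    exact Finset.prod_eq_zero (Finset.mem_univ i) (sub_self _)
  obtain ⟨φ, hφ0, hφ⟩ := Matrix.exists_mulVec_eq_zero_iff.2 hdet
  have hne : Nonempty W := ⟨i⟩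
  obtain ⟨u, hu⟩ := Finite.exists_max fun v => ‖φ v‖
  have hu0 : 0 < ‖φ u‖ := by
    obtain ⟨v, hv⟩ := Function.ne_iff.1 hφ0
    exact (norm_pos_iff.2 hv).trans_le (hu v)
  have h1 : (hA.eigenvalues i : ℂ) * φ u = ∑ v, A u v * φ v := by
    have h2 := congrFun hφ u
    rw [Matrix.sub_mulVec] at h2
    refine (sub_eq_zero.1 ?_).symm
    simpa [Matrix.mulVec, dotProduct, Matrix.diagonal_apply] using h2
  have h3 : |hA.eigenvalues i| * ‖φ u‖ ≤ (∑ v, ‖A u v‖) * ‖φ u‖ := by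
    rw [← Real.norm_eq_abs, ← Complex.norm_real, ← norm_mul, h1, Finset.sum_mul]
    refine (norm_sum_le _ _).trans (Finset.sum_le_sum fun v _ => ?_)
    rw [norm_mul]
    exact mul_le_mul_of_nonneg_left (hu v) (norm_nonneg _)
  refine (le_of_mul_le_mul_right h3 hu0).trans ?_
  exact Finset.single_le_sum (f := fun u => ∑ v, ‖A u v‖)
    (fun u _ => Finset.sum_nonneg fun v _ => norm_nonneg _) (Finset.mem_univ u)

theorem Matrix.IsHermitian.prod_eigenvalues₀_sub {A : Matrix W W ℂ} (hA : A.IsHermitian) (t : ℝ) :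
    ((∏ k, (hA.eigenvalues₀ k - t) : ℝ) : ℂ) = (A - Matrix.scalar W (t : ℂ)).det := by
  rw [hA.det_sub_scalar_eq_prod_eigenvalues₀]
  push_cast
  rfl

/-- Near `x₀` the ordered eigenvalues stay in a compact box. Any cluster point of them is still
ordered and has the characteristic determinant of `A x₀`, so it is the eigenvalue vector at `x₀`. -/
theorem Matrix.IsHermitian.continuous_eigenvalues₀ {A : X → Matrix W W ℂ}
    (hA : ∀ x, (A x).IsHermitian) (hc : Continuous A) (k : Fin (Fintype.card W)) :
    Continuous fun x => (hA x).eigenvalues₀ k := by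
  suffices h : Continuous fun x => (hA x).eigenvalues₀ from (continuous_apply k).comp h
  refine continuous_iff_continuousAt.2 fun x₀ => ?_
  have hentry : ∀ u v, Continuous fun x => A x u v := fun u v =>
    (continuous_apply v).comp ((continuous_apply u).comp hc)
  set B : ℝ := (∑ u, ∑ v, ‖A x₀ u v‖) + 1 with hB
  have hbd : ∀ᶠ x in 𝓝 x₀, ∑ u, ∑ v, ‖A x u v‖ < B := by
    have h1 : Continuous fun x => ∑ u, ∑ v, ‖A x u v‖ :=
      continuous_finsetSum _ fun u _ => continuous_finsetSum _ fun v _ => (hentry u v).norm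
    exact h1.continuousAt.eventually_lt_const (lt_add_one _)
  refine (isCompact_univ_pi fun _ : Fin (Fintype.card W) =>
    isCompact_Icc (a := -B) (b := B)).tendsto_nhds_of_unique_mapClusterPt ?_ ?_
  · filter_upwards [hbd] with x hx i _
    have h2 := (hA x).abs_eigenvalues_le ((Fintype.equivOfCardEq (Fintype.card_fin _)) i)
    rw [Matrix.IsHermitian.eigenvalues, Equiv.symm_apply_apply] at h2
    exact abs_le.1 (h2.trans hx.le)
  · intro μ _ hμ
    obtain ⟨U, hU, hlim⟩ := mapClusterPt_iff_ultrafilter.1 hμ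
    have hlimk : ∀ i, Tendsto (fun x => (hA x).eigenvalues₀ i) U (𝓝 (μ i)) :=
      tendsto_pi_nhds.1 hlim
    refine antitone_eq_of_prod_sub_eq (fun i j hij => ?_) (hA x₀).eigenvalues₀_antitone fun t => ?_
    · exact le_of_tendsto_of_tendsto' (hlimk j) (hlimk i) fun x => (hA x).eigenvalues₀_antitone hij
    · have h1 : Tendsto (fun x => ((∏ i, ((hA x).eigenvalues₀ i - t) : ℝ) : ℂ)) U
          (𝓝 ((∏ i, (μ i - t) : ℝ) : ℂ)) :=
        (Complex.continuous_ofReal.tendsto _).comp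
          (tendsto_finsetProd _ fun i _ => (hlimk i).sub_const t)
      have h2 : Tendsto (fun x => ((∏ i, ((hA x).eigenvalues₀ i - t) : ℝ) : ℂ)) U
          (𝓝 ((∏ i, ((hA x₀).eigenvalues₀ i - t) : ℝ) : ℂ)) := by
        simp only [Matrix.IsHermitian.prod_eigenvalues₀_sub]
        refine Tendsto.mono_left (Continuous.tendsto ?_ x₀) hU
        exact (hc.sub continuous_const).matrix_det
      exact_mod_cast tendsto_nhds_unique h1 h2

end Continuity

/-! ### Smooth branches of roots of the characteristic determinant -/

section Implicit

variable {W : Type} [Fintype W] [DecidableEq W] {d : ℕ}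

theorem contDiff_famDet (N : Matrix W W ℝ) (g : Fin d → W) (h : Fin d → ℝ) {n : WithTop ℕ∞} :
    ContDiff ℝ n fun q : (Fin d → ℝ) × ℝ => famDet N g h q.1 q.2 := by
  have hy : ∀ j, ContDiff ℝ n fun q : (Fin d → ℝ) × ℝ => q.1 j := fun j =>
    (contDiff_apply ℝ ℝ j).comp contDiff_fst
  simp only [famDet, diagFamily, Matrix.det_apply, Matrix.sub_apply, Matrix.add_apply,
    Matrix.diagonal_apply, Matrix.scalar_apply]
  refine ContDiff.sum fun σ _ => ContDiff.const_smul _ (contDiff_prod fun u _ => ?_)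
  refine (contDiff_const.add ?_).sub ?_
  · split_ifs
    · refine ContDiff.sum fun j _ => ?_
      split_ifs
      · exact contDiff_const.mul (hy j)
      · exact contDiff_const
    · exact contDiff_const
  · split_ifs
    · exact contDiff_snd
    · exact contDiff_const

/-- Near a point where the characteristic determinant has a simple root, its zero set is the graph
of a smooth function, whose partial derivatives vanish only where the corresponding minors do. -/
theorem exists_smooth_root (N : Matrix W W ℝ) (g : Fin d → W) (h : Fin d → ℝ) (hh : ∀ j, h j ≠ 0)
    (y₀ : Fin d → ℝ) (t₀ : ℝ) (h0 : famDet N g h y₀ t₀ = 0) {r : ℝ} (hr : r ≠ 0)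
    (h1 : HasDerivAt (fun t => famDet N g h y₀ t) r t₀) :
    ∃ Λ : (Fin d → ℝ) → ℝ, ContDiffAt ℝ 2 Λ y₀ ∧
      (∀ᶠ q in 𝓝 (y₀, t₀), famDet N g h q.1 q.2 = 0 → Λ q.1 = q.2) ∧
      ∀ j, fderiv ℝ Λ y₀ (Pi.single j 1) = 0 → famMinor N g h y₀ t₀ (g j) = 0 := by
  set F : (Fin d → ℝ) × ℝ → ℝ := fun q => famDet N g h q.1 q.2 with hF
  have hFc : ContDiffAt ℝ 2 F (y₀, t₀) := (contDiff_famDet N g h).contDiffAt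
  have hFd : HasFDerivAt F (fderiv ℝ F (y₀, t₀)) (y₀, t₀) :=
    (hFc.differentiableAt two_ne_zero).hasFDerivAt
  have hr' : fderiv ℝ F (y₀, t₀) (0, 1) = r := by
    have h2 : HasDerivAt (fun t : ℝ => (y₀, t)) ((0 : Fin d → ℝ), (1 : ℝ)) t₀ :=
      (hasDerivAt_const t₀ y₀).prodMk (hasDerivAt_id t₀)
    exact (hFd.comp_hasDerivAt t₀ h2).unique h1
  have hinv : (fderiv ℝ F (y₀, t₀) ∘L .inr ℝ (Fin d → ℝ) ℝ).IsInvertible := by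
    refine ⟨ContinuousLinearEquiv.unitsEquivAut ℝ (Units.mk0 r hr), ?_⟩
    ext
    simp [hr']
  refine ⟨hFc.implicitFunction two_ne_zero hinv, hFc.contDiffAt_implicitFunction two_ne_zero hinv,
    ?_, fun j hj => ?_⟩
  · filter_upwards [hFc.eventually_apply_eq_iff_implicitFunction two_ne_zero hinv] with q hq hq0
    exact hq.1 (hq0.trans h0.symm)
  · set Λ := hFc.implicitFunction two_ne_zero hinv with hΛ
    have hΛ0 : Λ y₀ = t₀ := hFc.implicitFunction_apply_self two_ne_zero hinv
    have hΛd : HasFDerivAt Λ (fderiv ℝ Λ y₀) y₀ :=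
      ((hFc.contDiffAt_implicitFunction two_ne_zero hinv).differentiableAt
        two_ne_zero).hasFDerivAt
    have h2 : HasFDerivAt (fun y => F (y, Λ y))
        ((fderiv ℝ F (y₀, t₀)).comp ((ContinuousLinearMap.id ℝ _).prod (fderiv ℝ Λ y₀))) y₀ := by
      have h3 : HasFDerivAt F (fderiv ℝ F (y₀, t₀)) (y₀, Λ y₀) := by rwa [hΛ0]
      exact HasFDerivAt.comp (g := F) y₀ h3 ((hasFDerivAt_id y₀).prodMk hΛd)
    -- Differentiating `F (y, Λ y) = 0` shows that where `∂Λ/∂y j` vanishes, so does `∂F/∂y j`. By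
    -- affine dependence the latter is `h j` times the minor.
    have h3 : (fun y => F (y, Λ y)) =ᶠ[𝓝 y₀] fun _ => 0 :=
      (hFc.eventually_apply_implicitFunction two_ne_zero hinv).mono fun y hy => hy.trans h0
    have h4 := DFunLike.congr_fun (h2.unique ((hasFDerivAt_const (0 : ℝ) y₀).congr_of_eventuallyEq h3))
      (Pi.single j 1)
    have h5 : fderiv ℝ F (y₀, t₀) (Pi.single j 1, 0) = 0 := by
      simpa [hj] using h4
    have h6 : HasDerivAt (fun s : ℝ => F (Function.update y₀ j s, t₀)) (h j * famMinor N g h y₀ t₀ (g j))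
        (y₀ j) := by
      simp only [hF, famDet_update]
      have h7 := ((((hasDerivAt_id (y₀ j)).sub_const (y₀ j)).const_mul (h j)).mul_const
        (famMinor N g h y₀ t₀ (g j))).const_add (famDet N g h y₀ t₀)
      simpa using h7
    have h8 : HasDerivAt (fun s : ℝ => (Function.update y₀ j s, t₀))
        ((Pi.single j 1 : Fin d → ℝ), (0 : ℝ)) (y₀ j) :=
      (hasDerivAt_update y₀ j (y₀ j)).prodMk (hasDerivAt_const _ _)
    have h9 : HasDerivAt (fun s : ℝ => F (Function.update y₀ j s, t₀))
        (fderiv ℝ F (y₀, t₀) (Pi.single j 1, 0)) (y₀ j) := by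
      have h10 : HasFDerivAt F (fderiv ℝ F (y₀, t₀)) (Function.update y₀ j (y₀ j), t₀) := by
        rwa [Function.update_eq_self]
      exact HasFDerivAt.comp_hasDerivAt (l := F) (y₀ j) h10 h8
    rw [h5] at h9
    exact (mul_eq_zero.1 (h6.unique h9)).resolve_left (hh j)

end Implicit

/-- The sums `z j + (z j)⁻¹` along the translates of a point of the torus, in angular
coordinates. -/
def torusSum {d : ℕ} (z : Fin d → Circle) (θ : Fin d → ℝ) : Fin d → ℝ := fun j =>
  2 * ((z j : ℂ).re * Real.cos (θ j) - (z j : ℂ).im * Real.sin (θ j))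

section TorusSum

variable {d : ℕ} (z : Fin d → Circle)

theorem ofReal_torusSum (θ : Fin d → ℝ) :
    (fun j => ((z j * Circle.exp (θ j) : Circle) : ℂ) + ((z j * Circle.exp (θ j) : Circle) : ℂ)⁻¹)
      = Complex.ofRealHom ∘ torusSum z θ := by
  ext j
  rw [← Circle.coe_inv, Circle.coe_inv_eq_conj, Complex.add_conj, Circle.coe_mul, Complex.mul_re,
    Circle.coe_exp, Complex.exp_ofReal_mul_I_re, Complex.exp_ofReal_mul_I_im]
  simp [torusSum]

theorem contDiff_torusSum {n : WithTop ℕ∞} : ContDiff ℝ n (torusSum z) := by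
  refine contDiff_pi.2 fun j => ?_
  have h1 : ContDiff ℝ n fun θ : Fin d → ℝ => θ j := contDiff_apply ℝ ℝ j
  exact contDiff_const.mul ((contDiff_const.mul h1.cos).sub (contDiff_const.mul h1.sin))

theorem fderiv_torusSum_single (θ : Fin d → ℝ) (j : Fin d) :
    fderiv ℝ (torusSum z) θ (Pi.single j 1)
      = (-2 * ((z j : ℂ).re * Real.sin (θ j) + (z j : ℂ).im * Real.cos (θ j))) •
        (Pi.single j 1 : Fin d → ℝ) := by
  have h : HasFDerivAt (torusSum z) (fderiv ℝ (torusSum z) θ) (Function.update θ j (θ j)) := by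
    rw [Function.update_eq_self]
    exact ((contDiff_torusSum z (n := 1)).differentiable one_ne_zero θ).hasFDerivAt
  have h1 := HasFDerivAt.comp_hasDerivAt (l := torusSum z) (θ j) h (hasDerivAt_update θ j (θ j))
  refine h1.unique (hasDerivAt_pi.2 fun i => ?_)
  rcases eq_or_ne i j with rfl | hij
  · have h2 := (((Real.hasDerivAt_cos (θ i)).const_mul (z i : ℂ).re).sub
      ((Real.hasDerivAt_sin (θ i)).const_mul (z i : ℂ).im)).const_mul 2
    convert! h2 using 1
    · ext t
      simp [torusSum]
    · simp
      ring
  · convert! hasDerivAt_const (θ j) (torusSum z θ i) using 1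
    · ext t
      simp [torusSum, hij]
    · simp [hij]

end TorusSum

theorem isCornerPoint_iff_im_eq_zero {d : ℕ} (z : Fin d → Circle) :
    IsCornerPoint (fun j => (z j : ℂ)) ↔ ∀ j, (z j : ℂ).im = 0 := by
  refine forall_congr' fun j => ⟨?_, fun h => ?_⟩
  · rintro (h | h) <;> simp [h]
  · have h1 := Circle.normSq_coe (z j)
    rw [Complex.normSq_apply, h, mul_zero, add_zero, mul_self_eq_one_iff] at h1
    exact h1.imp (fun h1 => Complex.ext h1 h) fun h1 => Complex.ext h1 (by simpa using h)

/-! ### Band functions near their extrema -/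

namespace Labeling

variable {d : ℕ} {W : Type} [Fintype W] [DecidableEq W] {Γ : PeriodicGraph d W}

namespace HasDiagForm

variable {L : Labeling Γ} {N : Matrix W W ℝ} {g : Fin d → W} {h : Fin d → ℝ}

theorem continuous_band (hL : L.HasDiagForm N g h) (k : Fin (Fintype.card W)) :
    Continuous (L.band k) := by
  refine Matrix.IsHermitian.continuous_eigenvalues₀ (fun z => L.floquet_isHermitian z) ?_ k
  have h1 : ∀ j, Continuous fun z : Fin d → Circle => (z j : ℂ) := fun j =>
    continuous_subtype_val.comp (continuous_apply j)
  have h2 : ∀ j, Continuous fun z : Fin d → Circle => ((z j : ℂ))⁻¹ := fun j =>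
    (h1 j).inv₀ fun z => Circle.coe_ne_zero _
  simp only [hL _, diagFamily]
  refine continuous_const.add (Continuous.matrix_diagonal (continuous_pi fun v =>
    continuous_finsetSum _ fun j _ => ?_))
  split_ifs
  · exact continuous_const.mul ((h1 j).add (h2 j))
  · exact continuous_const

/-- This passes from eigenvalues of complex Hermitian matrices to roots of a real family depending
on the angles only through `torusSum`. -/
theorem prod_band_sub (hL : L.HasDiagForm N g h) (z : Fin d → Circle) (θ : Fin d → ℝ) (t : ℝ) :
    ∏ k, (L.localBand k z θ - t) = famDet N g h (torusSum z θ) t := by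
  have h1 := (L.floquet_isHermitian fun j => z j * Circle.exp (θ j)).prod_eigenvalues₀_sub t
  have h2 := famDet_map Complex.ofRealHom N g h (torusSum z θ) t
  rw [← ofReal_torusSum] at h2
  refine Complex.ofReal_injective (h1.trans (Eq.trans ?_ h2.symm))
  exact hL.dispersion_eq (fun j => ((z j * Circle.exp (θ j) : Circle) : ℂ), (t : ℂ))

theorem localBand_zero (k : Fin (Fintype.card W)) (z : Fin d → Circle) :
    L.localBand k z 0 = L.band k z := by
  simp [localBand]

theorem continuous_angular (z : Fin d → Circle) :
    Continuous fun (θ : Fin d → ℝ) j => z j * Circle.exp (θ j) :=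
  continuous_pi fun j => continuous_const.mul (Circle.exp.continuous.comp (continuous_apply j))

/-- A band function is smooth, as a function of the sums `z j + (z j)⁻¹`, near a point where it
meets no other band function. -/
theorem exists_localBand_eq (hL : L.HasDiagForm N g h) (hh : ∀ j, h j ≠ 0)
    (k : Fin (Fintype.card W)) (z : Fin d → Circle)
    (hsimple : ∀ k', k' ≠ k → L.band k' z ≠ L.band k z) :
    ∃ Λ : (Fin d → ℝ) → ℝ, ContDiffAt ℝ 2 Λ (torusSum z 0) ∧
      L.localBand k z =ᶠ[𝓝 0] Λ ∘ torusSum z ∧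
      ∀ j, fderiv ℝ Λ (torusSum z 0) (Pi.single j 1) = 0 →
        (L.charMat (fun i => (z i : ℂ), (L.band k z : ℂ))).adjugate (g j) (g j) = 0 := by
  have hroot : ∀ θ, famDet N g h (torusSum z θ) (L.localBand k z θ) = 0 := fun θ => by
    rw [← hL.prod_band_sub]
    exact Finset.prod_eq_zero (Finset.mem_univ k) (sub_self _)
  have hder : HasDerivAt (fun t => famDet N g h (torusSum z 0) t)
      (-∏ k' ∈ Finset.univ.erase k, (L.localBand k' z 0 - L.localBand k z 0))
      (L.localBand k z 0) := by
    simp only [← hL.prod_band_sub]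
    exact hasDerivAt_prod_sub (fun k' => L.localBand k' z 0) k
  obtain ⟨Λ, hΛ, hev, hminor⟩ := exists_smooth_root N g h hh (torusSum z 0) (L.localBand k z 0)
    (hroot 0) (by
      refine neg_ne_zero.2 (Finset.prod_ne_zero_iff.2 fun k' hk' => ?_)
      simp only [localBand_zero]
      exact sub_ne_zero.2 (hsimple k' (Finset.ne_of_mem_erase hk'))) hder
  refine ⟨Λ, hΛ, ?_, fun j hj => ?_⟩
  · have hcont : Tendsto (fun θ => (torusSum z θ, L.localBand k z θ)) (𝓝 0)
        (𝓝 (torusSum z 0, L.localBand k z 0)) :=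
      ((contDiff_torusSum z (n := 0)).continuous.prodMk
        ((hL.continuous_band k).comp (continuous_angular z))).tendsto 0
    exact (hcont.eventually hev).mono fun θ hθ => (hθ (hroot θ)).symm
  · have h1 := famMinor_map Complex.ofRealHom N g h (torusSum z 0) (L.localBand k z 0) (g j)
    rw [hminor j hj, map_zero, ← ofReal_torusSum] at h1
    rw [hL.adjugate_charMat, h1]
    simp [localBand_zero]

/-- Where the band is simple it is `Λ ∘ torusSum z`, and the chain rule makes `Im (z j)` or `∂Λ/∂y
j` vanish. Where bands meet no derivative is needed: a double eigenvalue has an eigenvector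
vanishing at `g j`, so the minor there is zero. -/
theorem isCritical_of_isLocalExtr (hL : L.HasDiagForm N g h) (hh : ∀ j, h j ≠ 0)
    {k : Fin (Fintype.card W)} {z : Fin d → Circle} (hz : IsLocalExtr (L.band k) z) :
    L.IsCritical (fun i => (z i : ℂ), (L.band k z : ℂ)) := by
  have hdisp : L.dispersion (fun i => (z i : ℂ), (L.band k z : ℂ)) = 0 := by
    have h1 := (L.floquet_isHermitian z).prod_eigenvalues₀_sub (L.band k z)
    rw [dispersion, charMat, ← h1, Finset.prod_eq_zero (Finset.mem_univ k) (sub_self _),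
      Complex.ofReal_zero]
  refine (hL.isCritical_iff hh _).2 ⟨fun i => Circle.coe_ne_zero _, hdisp, fun j => ?_⟩
  by_cases hsimple : ∀ k', k' ≠ k → L.band k' z ≠ L.band k z
  · obtain ⟨Λ, hΛ, hev, hminor⟩ := hL.exists_localBand_eq hh k z hsimple
    have hext : IsLocalExtr (L.localBand k z) 0 := by
      have h1 : ContinuousAt (fun (θ : Fin d → ℝ) j => z j * Circle.exp (θ j)) 0 :=
        (continuous_angular z).continuousAt
      refine IsLocalExtr.comp_continuous (f := L.band k) ?_ h1
      simpa using hz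
    have h2 := (hext.congr hev).fderiv_eq_zero
    have hy : DifferentiableAt ℝ (torusSum z) 0 :=
      (contDiff_torusSum z (n := 1)).differentiable one_ne_zero 0
    rw [fderiv_comp 0 (hΛ.differentiableAt two_ne_zero) hy] at h2
    have h3 := DFunLike.congr_fun h2 (Pi.single j 1)
    rw [ContinuousLinearMap.comp_apply, fderiv_torusSum_single, map_smul, smul_eq_mul] at h3
    rcases mul_eq_zero.1 h3 with h4 | h4
    · left
      have h5 : (z j : ℂ).im = 0 := by simpa using h4
      -- The corner criterion is applied to the one-dimensional torus through the single coordinate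
      -- `z j`.
      exact (isCornerPoint_iff_im_eq_zero fun _ : Fin 1 => z j).2 (fun _ => h5) 0
    · exact Or.inr (hminor j h4)
  · push Not at hsimple
    obtain ⟨k', hk', he⟩ := hsimple
    right
    let e := Fintype.equivOfCardEq (α := Fin (Fintype.card W)) (β := W) (Fintype.card_fin _)
    have h1 : ∀ k, (L.floquet_isHermitian z).eigenvalues (e k) = L.band k z := fun k => by
      rw [Matrix.IsHermitian.eigenvalues, Equiv.symm_apply_apply, band]
    obtain ⟨φ, hφ, hφ0, hφk⟩ := (L.floquet_isHermitian z).exists_eigenvector_apply_eq_zero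
      (i := e k) (j := e k') (fun h2 => hk' (e.injective h2).symm) (by rw [h1, h1, he]) (g j)
    rw [h1] at hφk
    exact (Matrix.adjugate_self_eq_zero_iff _ _).2 ⟨φ, hφ, hφ0, fun v _ => congrFun hφk v⟩

/-- Around a corner point the `j`-th angular derivative is `-2 * Re (z j) * sin (θ j) * ∂Λ/∂y j`.
Since `sin` vanishes at `0`, the second derivatives only see the derivative of `sin (θ j)`, and the
Hessian is diagonal; a zero entry would force a vanishing minor. -/
theorem bandHessian_det_ne_zero (hL : L.HasDiagForm N g h) (hh : ∀ j, h j ≠ 0)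
    {k : Fin (Fintype.card W)} {z : Fin d → Circle} (hz : IsCornerPoint fun i => (z i : ℂ))
    (hsimple : ∀ k', k' ≠ k → L.band k' z ≠ L.band k z)
    (hadj : ∀ j, (L.charMat (fun i => (z i : ℂ), (L.band k z : ℂ))).adjugate (g j) (g j) ≠ 0) :
    ContDiffAt ℝ 2 (L.localBand k z) 0 ∧ (L.bandHessian k z).det ≠ 0 := by
  obtain ⟨Λ, hΛ, hev, hminor⟩ := hL.exists_localBand_eq hh k z hsimple
  have hy : ContDiff ℝ 2 (torusSum z) := contDiff_torusSum z
  have hcomp : ContDiffAt ℝ 2 (Λ ∘ torusSum z) 0 := hΛ.comp 0 hy.contDiffAt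
  have hband : ContDiffAt ℝ 2 (L.localBand k z) 0 := hcomp.congr_of_eventuallyEq hev
  refine ⟨hband, ?_⟩
  have him := (isCornerPoint_iff_im_eq_zero z).1 hz
  set a : Fin d → ℝ := fun j => fderiv ℝ Λ (torusSum z 0) (Pi.single j 1) with ha
  have hH : L.bandHessian k z = Matrix.diagonal fun j => -2 * (z j : ℂ).re * a j := by
    ext i j
    rw [bandHessian, Matrix.of_apply, iteratedFDeriv_two_apply]
    simp only [Matrix.cons_val_zero, Matrix.cons_val_one]
    have hG : DifferentiableAt ℝ (fderiv ℝ (L.localBand k z)) 0 :=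
      (hband.fderiv_right (m := 1) le_rfl).differentiableAt one_ne_zero
    have h1 : fderiv ℝ (fderiv ℝ (L.localBand k z)) 0 (Pi.single i 1) (Pi.single j 1)
        = fderiv ℝ (fun θ => fderiv ℝ (L.localBand k z) θ (Pi.single j 1)) 0 (Pi.single i 1) := by
      rw [(hG.hasFDerivAt.clm_apply (hasFDerivAt_const (Pi.single j 1 : Fin d → ℝ) (0 : Fin d → ℝ))).fderiv]
      simp
    have hΛev : ∀ᶠ y in 𝓝 (torusSum z 0), ContDiffAt ℝ 2 Λ y := hΛ.eventually (by simp)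
    have h2 : (fun θ => fderiv ℝ (L.localBand k z) θ (Pi.single j 1)) =ᶠ[𝓝 0] fun θ =>
        (-2 * (z j : ℂ).re * Real.sin (θ j)) * fderiv ℝ Λ (torusSum z θ) (Pi.single j 1) := by
      filter_upwards [hev.fderiv (𝕜 := ℝ), hy.continuous.continuousAt.eventually hΛev] with θ h3 h4
      rw [h3, fderiv_comp θ (h4.differentiableAt two_ne_zero)
        (hy.differentiable two_ne_zero θ), ContinuousLinearMap.comp_apply,
        fderiv_torusSum_single, map_smul, smul_eq_mul, him j]
      ring
    have h3 : DifferentiableAt ℝ (fun θ => fderiv ℝ Λ (torusSum z θ) (Pi.single j 1)) 0 := by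
      have h4 : DifferentiableAt ℝ (fderiv ℝ Λ) (torusSum z 0) :=
        (hΛ.fderiv_right (m := 1) le_rfl).differentiableAt one_ne_zero
      exact (h4.comp (0 : Fin d → ℝ) (hy.differentiable two_ne_zero 0)).clm_apply
        (differentiableAt_const (Pi.single j 1 : Fin d → ℝ))
    have h5 : HasFDerivAt (fun θ : Fin d → ℝ => -2 * (z j : ℂ).re * Real.sin (θ j))
        ((-2 * (z j : ℂ).re) • ContinuousLinearMap.proj (R := ℝ) (φ := fun _ : Fin d => ℝ) j) 0 := by
      have h6 : HasFDerivAt (fun θ : Fin d → ℝ => θ j)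
          (ContinuousLinearMap.proj (R := ℝ) (φ := fun _ : Fin d => ℝ) j) 0 := hasFDerivAt_apply j 0
      have h7 := h6.sin.const_mul (-2 * (z j : ℂ).re)
      rwa [Pi.zero_apply, Real.cos_zero, one_smul] at h7
    rw [h1, h2.fderiv_eq, (h5.fun_mul h3.hasFDerivAt).fderiv]
    rcases eq_or_ne i j with rfl | hij
    · simp [ha]
      ring
    · simp [hij]
  rw [hH, Matrix.det_diagonal, Finset.prod_ne_zero_iff]
  intro j _
  refine mul_ne_zero (mul_ne_zero (by norm_num) fun h0 => Circle.coe_ne_zero (z j)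
    (Complex.ext h0 (him j))) fun h0 => hadj j (hminor j h0)

theorem hasGoodSpectralEdges (hL : L.HasDiagForm N g h) (hN : N.IsSymm) (hh : ∀ j, h j ≠ 0)
    (hd : 0 < d) (hcrit : ∀ p, L.IsCritical p → IsCornerPoint p.1)
    (hker : ∀ x, IsCornerPoint x → ∀ t j, ∀ φ : W → ℂ,
      (L.charMat (x, t)).mulVec φ = 0 → φ (g j) = 0 → φ = 0) :
    L.HasGoodSpectralEdges := by
  have hcorner : ∀ {k z}, IsLocalExtr (L.band k) z → IsCornerPoint fun i => (z i : ℂ) :=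
    fun hz => hcrit _ (hL.isCritical_of_isLocalExtr hh hz)
  intro k z hz
  have hx := hcorner hz
  have hdisp := (hL.isCritical_of_isLocalExtr hh hz).2 none
  have hsimple : ∀ k', k' ≠ k → L.band k' z ≠ L.band k z := by
    intro k' hk' he
    let e := Fintype.equivOfCardEq (α := Fin (Fintype.card W)) (β := W) (Fintype.card_fin _)
    have h1 : ∀ k, (L.floquet_isHermitian z).eigenvalues (e k) = L.band k z := fun k => by
      rw [Matrix.IsHermitian.eigenvalues, Equiv.symm_apply_apply, band]
    obtain ⟨φ, hφ, hφ0, hφk⟩ := (L.floquet_isHermitian z).exists_eigenvector_apply_eq_zero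
      (i := e k) (j := e k') (fun h2 => hk' (e.injective h2).symm) (by rw [h1, h1, he]) (g ⟨0, hd⟩)
    exact hφ (hker _ hx _ _ φ hφk hφ0)
  refine ⟨?_, hL.bandHessian_det_ne_zero hh hx hsimple fun j =>
    Matrix.adjugate_ne_zero_of_symm (hL.charMat_isSymm hN _) hdisp (hker _ hx _ j), hsimple⟩
  -- Isolation comes from finiteness: all extrema lie over corner points, with finitely many bands
  -- above each.
  have hfin : L.extrema.Finite := by
    have h1 : {z : Fin d → Circle | IsCornerPoint fun i => (z i : ℂ)}.Finite := by
      refine (Set.Finite.pi' (t := fun _ : Fin d => {c : Circle | (c : ℂ) = 1 ∨ (c : ℂ) = -1})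
        fun _ => ?_).subset fun z hz i => hz i
      refine Set.Finite.preimage (f := fun c : Circle => (c : ℂ)) (Circle.coe_injective.injOn)
        (Set.toFinite {(1 : ℂ), -1})
    refine ((h1.prod (Set.finite_univ (α := Fin (Fintype.card W)))).image
      fun q => (q.1, L.band q.2 q.1)).subset ?_
    rintro ⟨z', t⟩ ⟨k', hk', ht⟩
    exact ⟨(z', k'), ⟨hcorner hk', trivial⟩, Prod.ext rfl ht⟩
  have hcl : IsClosed (L.extrema \ {(z, L.band k z)}) := (hfin.subset Set.sdiff_subset).isClosed
  have h2 := hcl.isOpen_compl.mem_nhds (x := (z, L.band k z)) (by simp)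
  filter_upwards [mem_nhdsWithin_of_mem_nhds h2, self_mem_nhdsWithin] with p hp hne hpe
  exact hp ⟨hpe, hne⟩

end HasDiagForm

end Labeling

/-! ### The Floquet matrix of an isthmus-connected graph -/

namespace IsthmusGraph

section Adjacency

variable {G : IsthmusGraph}

theorem idx_isthmusVert (i : Fin G.m) : G.idx (G.isthmusVert i) = 1 + (i : ℤ) := rfl

theorem eq_of_idx_eq {u v : G.Vert} (h1 : 1 ≤ G.idx u) (h2 : G.idx u ≤ G.m)
    (h : G.idx u = G.idx v) : u = v := by
  rcases u with u | u | u <;> rcases v with v | v | v <;> simp only [idx] at h1 h2 h <;>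
    first
    | (congr 2; exact Fin.ext (by omega))
    | omega

theorem exists_idx_eq {i : ℤ} (h1 : 1 ≤ i) (h2 : i ≤ G.m) : ∃ v : G.Vert, G.idx v = i :=
  ⟨G.isthmusVert ⟨(i - 1).toNat, by omega⟩, by rw [idx_isthmusVert]; simp; omega⟩

theorem not_adj_of_idx_lt {u v : G.Vert} {i : ℤ} (h1 : 1 ≤ i) (h2 : i ≤ G.m) (hu : G.idx u < i)
    (hv : i < G.idx v) : ¬ G.graph.Adj u v := by
  rw [graph, SimpleGraph.fromRel_adj]
  rintro ⟨-, h⟩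
  rcases u with u | u | u <;> rcases v with v | v | v <;> simp [idx, edgeRel] at hu hv h <;>
    omega

theorem adj_of_idx {u v : G.Vert} (hu : 1 ≤ G.idx u) (h : G.idx u + 1 = G.idx v)
    (hv : G.idx v ≤ G.m) : G.graph.Adj u v := by
  rw [graph, SimpleGraph.fromRel_adj]
  refine ⟨by rintro rfl; omega, Or.inl ?_⟩
  rcases u with u | u | u <;> rcases v with v | v | v <;> simp only [idx, edgeRel] at hu hv h ⊢ <;>
    omega

end Adjacency

variable {G : IsthmusGraph} {d : ℕ} {f : Fin d → Fin G.m}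

theorem adj_base_iff {v u : G.Vert} {c : Fin d → ℤ} (hvu : v ≠ u) :
    (G.periodicGraph f).graph.Adj (0, v) (c, u) ↔ 0 = c ∧ G.graph.Adj v u := by
  refine ⟨?_, fun h => Or.inl h⟩
  rintro (h | ⟨j, h1, h2, -⟩)
  · exact h
  · exact absurd (h1.trans h2.symm) hvu

theorem adj_hop_iff {v : G.Vert} {c : Fin d → ℤ} :
    (G.periodicGraph f).graph.Adj (0, v) (c, v) ↔
      ∃ j, G.isthmusVert (f j) = v ∧ (c = Pi.single j 1 ∨ c = -Pi.single j 1) := by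
  constructor
  · rintro (⟨-, h⟩ | ⟨j, h1, -, h2⟩)
    · exact absurd h (G.graph.loopless.irrefl _)
    · refine ⟨j, h1.symm, h2.imp (fun h => by simpa using h) fun h => ?_⟩
      exact eq_neg_of_add_eq_zero_left h.symm
  · rintro ⟨j, h1, h2⟩
    refine Or.inr ⟨j, h1.symm, h1.symm, h2.imp (fun h => by simpa using h) fun h => ?_⟩
    simp [h]

theorem adj_hop (j : Fin d) : (G.periodicGraph f).graph.Adj (0, G.isthmusVert (f j))
    (Pi.single j 1, G.isthmusVert (f j)) :=
  adj_hop_iff.2 ⟨j, rfl, Or.inl rfl⟩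

/-- The parameters of a labeling: values of the potential and edge weights. -/
abbrev Params (G : IsthmusGraph) {d : ℕ} (f : Fin d → Fin G.m) : Type :=
  ((Fin d → ℤ) × G.Vert) ⊕ (G.periodicGraph f).graph.edgeSet

section Matrix

variable {R : Type} [CommRing R]

open Classical in
/-- The part of the Floquet matrix coming from the potential and from the edges inside a copy of
the isthmus graph. -/
def baseMatrix (c : Params G f → R) : Matrix G.Vert G.Vert R :=
  Matrix.of fun v u => if v = u then c (.inl (0, v)) else
    if h : (G.periodicGraph f).graph.Adj (0, v) (0, u) then
      c (.inr ⟨s(((0 : Fin d → ℤ), v), (0, u)), h⟩)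
    else 0

/-- The weights of the edges between `(α, f j)` and `(α + e_j, f j)`. -/
def hopWeight (c : Params G f → R) (j : Fin d) : R :=
  c (.inr ⟨s((0, G.isthmusVert (f j)), (Pi.single j 1, G.isthmusVert (f j))), adj_hop j⟩)

theorem baseMatrix_map {S : Type} [CommRing S] (φ : R →+* S) (c : Params G f → R) :
    (baseMatrix c).map φ = baseMatrix (φ ∘ c) := by
  ext v u
  simp only [baseMatrix, Matrix.map_apply, Matrix.of_apply]
  split_ifs <;> simp

theorem baseMatrix_isSymm (c : Params G f → R) : (baseMatrix c).IsSymm := by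
  ext v u
  simp only [Matrix.transpose_apply, baseMatrix, Matrix.of_apply]
  rcases eq_or_ne v u with rfl | hvu
  · rfl
  rw [if_neg hvu, if_neg hvu.symm]
  by_cases h : (G.periodicGraph f).graph.Adj (0, v) (0, u)
  · rw [dif_pos h, dif_pos h.symm]
    congr 3
    exact Sym2.eq_swap
  · rw [dif_neg h, dif_neg fun h' => h h'.symm]

end Matrix

/-- The vectors `±e_j` are pairwise distinct, so for given `c` at most one term on the right is
nonzero, even when several `f j` coincide. -/
theorem edgeTerm_self (L : Labeling (G.periodicGraph f)) (z : Fin d → ℂ) (v : G.Vert)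
    (c : Fin d → ℤ) : L.edgeTerm z v v c = ∑ j, if G.isthmusVert (f j) = v then
      (if c = Pi.single j 1 then ((hopWeight (Sum.elim L.V L.E) j : ℝ) : ℂ) * z j else 0)
      + (if c = -Pi.single j 1 then ((hopWeight (Sum.elim L.V L.E) j : ℝ) : ℂ) * (z j)⁻¹ else 0)
      else 0 := by
  have hpn : ∀ i j : Fin d, (Pi.single i 1 : Fin d → ℤ) ≠ -Pi.single j 1 := fun i j h => by
    have h1 := congrFun h i
    rcases eq_or_ne i j with rfl | hij
    · simp at h1
    · simp [hij] at h1
  have hpp : ∀ i j : Fin d, (Pi.single i 1 : Fin d → ℤ) = Pi.single j 1 → i = j := fun i j h => by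
    by_contra hij
    have h1 := congrFun h i
    simp [hij] at h1
  by_cases h : (G.periodicGraph f).graph.Adj (0, v) (c, v)
  · obtain ⟨j, rfl, rfl | rfl⟩ := adj_hop_iff.1 h
    · rw [Finset.sum_eq_single j, if_pos rfl, if_pos rfl, if_neg (hpn j j), add_zero,
        Labeling.edgeTerm, dif_pos h]
      · congr 1
        rw [Finset.prod_eq_single j]
        · simp
        · intro i _ hi
          simp [hi]
        · simp
      · intro i _ hi
        rw [if_neg fun he => hi (hpp j i he).symm, if_neg (hpn j i), add_zero, ite_self]
      · simp
    · rw [Finset.sum_eq_single j, if_pos rfl, if_pos rfl, if_neg (hpn j j).symm, zero_add,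
        Labeling.edgeTerm, dif_pos h]
      · congr 1
        -- Translation by `e_j` turns the edge towards `-e_j` into the edge towards `e_j`, reversed.
        · rw [hopWeight, Sum.elim_inr, ← L.E_periodic (Pi.single j 1) _ _ h]
          congr 3
          simp [shiftVert, Sym2.eq_swap]
        · rw [Finset.prod_eq_single j]
          · simp
          · intro i _ hi
            simp [hi]
          · simp
      · intro i _ hi
        rw [if_neg (hpn i j).symm, if_neg fun he => hi (hpp j i (neg_injective he)).symm, add_zero,
          ite_self]
      · simp
  · rw [Labeling.edgeTerm, dif_neg h, Finset.sum_eq_zero]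
    intro j _
    by_cases hj : G.isthmusVert (f j) = v
    · rw [if_neg fun hc => h (adj_hop_iff.2 ⟨j, hj, Or.inl hc⟩),
        if_neg fun hc => h (adj_hop_iff.2 ⟨j, hj, Or.inr hc⟩), add_zero, ite_self]
    · rw [if_neg hj]

theorem hasDiagForm (L : Labeling (G.periodicGraph f)) :
    L.HasDiagForm (baseMatrix (Sum.elim L.V L.E)) (fun j => G.isthmusVert (f j))
      (hopWeight (Sum.elim L.V L.E)) := by
  intro z
  ext v u
  simp only [Labeling.floquet, Matrix.of_apply, diagFamily, Matrix.add_apply, Matrix.map_apply]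
  rcases eq_or_ne v u with rfl | hvu
  · rw [if_pos rfl, Matrix.diagonal_apply_eq]
    congr 1
    · simp [baseMatrix]
    · simp only [edgeTerm_self]
      have hs : ∀ (a : Fin d → ℤ) (r : ℂ), ((fun c => if c = a then r else 0).support).Finite :=
        fun a r => (Set.finite_singleton a).subset fun c hc => by
          by_contra h
          exact hc (if_neg h)
      have hf : ∀ (a : Fin d → ℤ) (r : ℂ), ∑ᶠ c, (if c = a then r else 0) = r := fun a r => by
        rw [finsum_eq_single _ a fun c hc => if_neg hc, if_pos rfl]
      rw [finsum_sum_comm]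
      · refine Finset.sum_congr rfl fun j _ => ?_
        split_ifs with hj
        · rw [finsum_add_distrib (hs _ _) (hs _ _), hf, hf, mul_add]
          rfl
        · exact finsum_zero
      · intro j _
        split_ifs with hj
        · exact ((hs _ _).union (hs _ _)).subset (Function.support_add _ _)
        · exact (Set.finite_empty).subset fun c hc => hc rfl
  · rw [if_neg hvu, zero_add, Matrix.diagonal_apply_ne _ hvu, add_zero, finsum_eq_single _ 0]
    · rw [Labeling.edgeTerm, baseMatrix, Matrix.of_apply, if_neg hvu]
      split_ifs <;> simp
    · intro c hc
      rw [Labeling.edgeTerm, dif_neg fun h => hc ((adj_base_iff hvu).1 h).1.symm]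

theorem baseMatrix_eq_zero {R : Type} [CommRing R] (c : Params G f → R) {u v : G.Vert} (huv : u ≠ v)
    (h : ¬ G.graph.Adj u v) : baseMatrix c u v = 0 := by
  rw [baseMatrix, Matrix.of_apply, if_neg huv, dif_neg fun h' => h ((adj_base_iff huv).1 h').2]

theorem baseMatrix_ne_zero {R : Type} [CommRing R] {c : Params G f → R} (hc : ∀ e, c (.inr e) ≠ 0)
    {u v : G.Vert} (h : G.graph.Adj u v) : baseMatrix c u v ≠ 0 := by
  rw [baseMatrix, Matrix.of_apply, if_neg h.ne, dif_pos ((adj_base_iff h.ne).2 ⟨rfl, h⟩)]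
  exact hc _

theorem charMat_apply_ne (L : Labeling (G.periodicGraph f)) (p : (Fin d → ℂ) × ℂ) {u v : G.Vert}
    (huv : u ≠ v) : L.charMat p u v = (baseMatrix (Sum.elim L.V L.E) u v : ℝ) := by
  rw [Labeling.charMat, hasDiagForm L]
  simp [diagFamily, huv]

theorem isIsthmusMatrix (L : Labeling (G.periodicGraph f)) (hE : ∀ e, L.E e ≠ 0)
    (p : (Fin d → ℂ) × ℂ) : IsIsthmusMatrix G.idx G.m (L.charMat p) where
  symm := (hasDiagForm L).charMat_isSymm (baseMatrix_isSymm _) p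
  inj _ _ := eq_of_idx_eq
  surj _ := exists_idx_eq
  cut u v i h1 h2 h3 h4 := by
    have huv : u ≠ v := by rintro rfl; omega
    rw [charMat_apply_ne L p huv, baseMatrix_eq_zero _ huv (not_adj_of_idx_lt h1 h2 h3 h4),
      Complex.ofReal_zero]
  path u v h1 h2 h3 := by
    have huv := adj_of_idx h1 h2 h3
    rw [charMat_apply_ne L p huv.ne]
    exact_mod_cast baseMatrix_ne_zero (c := Sum.elim L.V L.E) hE huv

/-- The characteristic matrix acts in the same way at two points where the coordinates that differ
belong to vertices at which the vector vanishes or which are not the vertex in question. -/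
theorem charMat_mulVec_congr (L : Labeling (G.periodicGraph f)) {z x : Fin d → ℂ} {t : ℂ}
    {φ : G.Vert → ℂ} {v : G.Vert}
    (h : ∀ j, z j = x j ∨ G.isthmusVert (f j) ≠ v ∨ φ (G.isthmusVert (f j)) = 0) :
    (L.charMat (z, t)).mulVec φ v = (L.charMat (x, t)).mulVec φ v := by
  simp only [Labeling.charMat, hasDiagForm L _, diagFamily, Matrix.sub_mulVec, Matrix.add_mulVec,
    Pi.sub_apply, Pi.add_apply, Matrix.mulVec_diagonal, Finset.sum_mul]
  congr 2
  refine Finset.sum_congr rfl fun j _ => ?_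
  by_cases hv : G.isthmusVert (f j) = v
  · rcases h j with h1 | h1 | h1
    · simp [h1]
    · exact absurd hv h1
    · rw [hv] at h1
      simp [h1]
  · simp [hv]

/-! ### Critical points for generic parameters -/

section Generic

variable {L : Labeling (G.periodicGraph f)} (hL : IsGeneric L)

include hL

/-- A nonzero kernel vector vanishing at `c` can be cut at `c`; a nonzero half makes `P` or `Q` at
the position of `c` vanish together with `D`. -/
theorem IsGeneric.eq_zero_of_kernel {x : Fin d → ℂ} (hx : IsCornerPoint x) {t : ℂ} {φ : G.Vert → ℂ}
    (hφ : (L.charMat (x, t)).mulVec φ = 0) {c : G.Vert} (h1 : 1 ≤ G.idx c) (h2 : G.idx c ≤ G.m)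
    (hc : φ c = 0) : φ = 0 := by
  by_contra h0
  have hI := isIsthmusMatrix L hL.1 (x, t)
  have hdet : L.dispersion (x, t) = 0 := Matrix.exists_mulVec_eq_zero_iff.1 ⟨φ, h0, hφ⟩
  have hgen := hL.2 x hx (G.idx c) (G.idx c) h1 le_rfl h2 t
  obtain ⟨v, hv⟩ := Function.ne_iff.1 h0
  rcases le_total (G.idx v) (G.idx c) with h3 | h3
  · refine hgen.2.1 ⟨(Matrix.det_submatrix_val_eq_zero_iff _ _).2 ?_, hdet⟩
    exact hI.exists_left_kernel h1 h2 hc (fun u _ => congrFun hφ u) h3 hv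
  · refine hgen.2.2 ⟨(Matrix.det_submatrix_val_eq_zero_iff _ _).2 ?_, hdet⟩
    obtain ⟨χ, h4, h5, h6⟩ := hI.reflect.exists_left_kernel (c := c) (by omega) (by omega) hc
      (fun u _ => congrFun hφ u) (by omega) hv
    exact ⟨χ, h4, fun u hu => h5 u (by omega), fun u hu => h6 u (by omega)⟩

theorem IsGeneric.hopWeight_ne_zero (j : Fin d) : hopWeight (Sum.elim L.V L.E) j ≠ 0 :=
  hL.1 ⟨_, adj_hop j⟩

/-- Vectors supported on one side of all the `f j` with `z j ≠ ±1` cannot distinguish `z` from a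
corner point `x`. The kernel alternative applied from the left and from the right therefore produces
roots that genericity forbids at `x`. -/
theorem IsGeneric.isCornerPoint_of_isCritical {p : (Fin d → ℂ) × ℂ} (hp : L.IsCritical p) :
    IsCornerPoint p.1 := by
  classical
  obtain ⟨z, t⟩ := p
  obtain ⟨-, hdet, hcrit⟩ := ((hasDiagForm L).isCritical_iff hL.hopWeight_ne_zero _).1 hp
  set J : Finset (Fin d) := Finset.univ.filter fun j => ¬ (z j = 1 ∨ z j = -1) with hJ
  by_contra hcon
  have hJne : J.Nonempty := by
    by_contra h
    rw [Finset.not_nonempty_iff_eq_empty, Finset.filter_eq_empty_iff] at h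
    exact hcon fun j => not_not.1 (h (Finset.mem_univ j))
  obtain ⟨j₁, hj₁, hmin⟩ := J.exists_min_image f hJne
  obtain ⟨j₂, hj₂, hmax⟩ := J.exists_max_image f hJne
  -- The value `1` is arbitrary: either sign at the coordinates in `J` would do.
  set x : Fin d → ℂ := fun j => if z j = 1 ∨ z j = -1 then z j else 1 with hxdef
  have hx : IsCornerPoint x := fun j => by
    simp only [hxdef]
    split_ifs with h
    · exact h
    · exact Or.inl rfl
  have hzx : ∀ j, z j = x j ∨ j ∈ J := fun j => by
    by_cases h : z j = 1 ∨ z j = -1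
    · exact Or.inl (by simp only [hxdef, if_pos h])
    · exact Or.inr (Finset.mem_filter.2 ⟨Finset.mem_univ j, h⟩)
  have hI := isIsthmusMatrix L hL.1 (z, t)
  set s := G.idx (G.isthmusVert (f j₁)) with hs
  set r := G.idx (G.isthmusVert (f j₂)) with hr
  have hs1 : 1 ≤ s := by rw [hs, idx_isthmusVert]; omega
  have hrm : r ≤ G.m := by rw [hr, idx_isthmusVert]; have := (f j₂).2; omega
  have hlow : ∀ j ∈ J, s ≤ G.idx (G.isthmusVert (f j)) := fun j hj => by
    have h1 : (f j₁ : ℕ) ≤ f j := hmin j hj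
    rw [hs, idx_isthmusVert, idx_isthmusVert]
    omega
  have hhigh : ∀ j ∈ J, G.idx (G.isthmusVert (f j)) ≤ r := fun j hj => by
    have h1 : (f j : ℕ) ≤ f j₂ := hmax j hj
    rw [hr, idx_isthmusVert, idx_isthmusVert]
    omega
  have hsr : s ≤ r := hlow j₂ hj₂
  have hadj : ∀ j ∈ J, (L.charMat (z, t)).adjugate (G.isthmusVert (f j)) (G.isthmusVert (f j)) = 0 :=
    fun j hj => (hcrit j).resolve_left (Finset.mem_filter.1 hj).2
  obtain ⟨g1, g2, g3⟩ := hL.2 x hx s r hs1 hsr hrm t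
  have hrow : ∀ (φ : G.Vert → ℂ) (v : G.Vert), (∀ j ∈ J, G.isthmusVert (f j) ≠ v ∨
      φ (G.isthmusVert (f j)) = 0) → (L.charMat (z, t)).mulVec φ v = 0 →
      (L.charMat (x, t)).mulVec φ v = 0 := fun φ v h h0 => by
    rw [← h0]
    exact (charMat_mulVec_congr L fun j => (hzx j).imp_right (h j)).symm
  refine g1 ⟨?_, ?_⟩
  · rcases hI.exists_left_or_right_kernel hdet hs1 (hadj j₁ hj₁) hsr hrm with
      ⟨χ, h1, h2, h3⟩ | ⟨ψ, h1, h2, h3⟩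
    · refine (Matrix.det_submatrix_val_eq_zero_iff _ _).2 ⟨χ, h1, h2, fun v hv => ?_⟩
      exact hrow χ v (fun j hj => Or.inr (h2 _ (not_lt.2 (hlow j hj)))) (h3 v hv)
    · have h4 : (L.charMat (x, t)).mulVec ψ = 0 := by
        ext v
        exact hrow ψ v (fun j hj => Or.inr (h3 _ (hhigh j hj))) (congrFun h2 v)
      refine absurd ⟨(Matrix.det_submatrix_val_eq_zero_iff _ _).2 ?_,
        Matrix.exists_mulVec_eq_zero_iff.1 ⟨ψ, h1, h4⟩⟩ g3
      exact ⟨ψ, h1, fun v hv => h3 v (not_lt.1 hv), fun v _ => congrFun h4 v⟩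
  -- In reflected positions, vanishing up to `m + 1 - s` means vanishing at all original positions
  -- `≥ s`, in particular at every `f j` with `j ∈ J`.
  · rcases hI.reflect.exists_left_or_right_kernel hdet (c := G.isthmusVert (f j₂)) (by omega)
      (hadj j₂ hj₂) (t := G.m + 1 - s) (by omega) (by omega) with
      ⟨χ, h1, h2, h3⟩ | ⟨ψ, h1, h2, h3⟩
    · refine (Matrix.det_submatrix_val_eq_zero_iff _ _).2 ⟨χ, h1, fun v hv => h2 v (by omega),
        fun v hv => ?_⟩
      exact hrow χ v (fun j hj => Or.inr (h2 _ (by have := hhigh j hj; omega))) (h3 v (by omega))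
    · have h4 : (L.charMat (x, t)).mulVec ψ = 0 := by
        ext v
        exact hrow ψ v (fun j hj => Or.inr (h3 _ (by have := hlow j hj; omega))) (congrFun h2 v)
      refine absurd ⟨(Matrix.det_submatrix_val_eq_zero_iff _ _).2 ?_,
        Matrix.exists_mulVec_eq_zero_iff.1 ⟨ψ, h1, h4⟩⟩ g2
      exact ⟨ψ, h1, fun v hv => h3 v (by omega), fun v _ => congrFun h4 v⟩

theorem IsGeneric.kernel_isthmusVert {x : Fin d → ℂ} (hx : IsCornerPoint x) (t : ℂ) (j : Fin d)
    (φ : G.Vert → ℂ) (hφ : (L.charMat (x, t)).mulVec φ = 0) (h0 : φ (G.isthmusVert (f j)) = 0) :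
    φ = 0 := by
  have h1 := (f j).2
  exact hL.eq_zero_of_kernel hx hφ (by rw [idx_isthmusVert]; omega)
    (by rw [idx_isthmusVert]; omega) h0

theorem IsGeneric.isCritical_iff (p : (Fin d → ℂ) × ℂ) :
    L.IsCritical p ↔ p ∈ L.blochVariety ∧ IsCornerPoint p.1 := by
  refine ⟨fun hp => ⟨⟨hp.1, hp.2 none⟩, hL.isCornerPoint_of_isCritical hp⟩, fun hp => ?_⟩
  exact ((hasDiagForm L).isCritical_iff hL.hopWeight_ne_zero p).2
    ⟨hp.1.1, hp.1.2, fun j => Or.inl (hp.2 j)⟩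

theorem IsGeneric.isNondegenerate (hd : 0 < d) {p : (Fin d → ℂ) × ℂ} (hp : L.IsCritical p) :
    L.IsNondegenerate p :=
  (hasDiagForm L).isNondegenerate (baseMatrix_isSymm _) hL.hopWeight_ne_zero hd
    (hL.isCornerPoint_of_isCritical hp) (hp.2 none)
    (hL.kernel_isthmusVert (hL.isCornerPoint_of_isCritical hp) p.2)

theorem IsGeneric.hasGoodSpectralEdges (hd : 0 < d) : L.HasGoodSpectralEdges :=
  (hasDiagForm L).hasGoodSpectralEdges (baseMatrix_isSymm _) hL.hopWeight_ne_zero hd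
    (fun _ => hL.isCornerPoint_of_isCritical) fun _ hx => hL.kernel_isthmusVert hx

end Generic

end IsthmusGraph

/-! ### Eigenvectors that do not vanish at a given vertex -/

section Observable

variable {W : Type} [Fintype W] [DecidableEq W]

/-- If no eigenvector of a symmetric matrix vanishes at `v`, then for a nonzero vector `b` only
finitely many of the systems `(A - t) ψ = b` have a solution vanishing at `v`. -/
theorem Matrix.IsHermitian.finite_setOf_solution_apply_eq_zero {A : Matrix W W ℝ}
    (hA : A.IsHermitian) {v : W}
    (hobs : ∀ (t : ℝ) (φ : W → ℝ), (A - Matrix.scalar W t).mulVec φ = 0 → φ v = 0 → φ = 0)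
    {b : W → ℝ} (hb : b ≠ 0) :
    {t : ℝ | ∃ ψ : W → ℝ, ψ v = 0 ∧ (A - Matrix.scalar W t).mulVec ψ = b}.Finite := by
  set μ := hA.eigenvalues with hμ
  set e : W → W → ℝ := fun k => ⇑(hA.eigenvectorBasis k) with he
  have hAe : ∀ k, A.mulVec (e k) = μ k • e k := hA.mulVec_eigenvectorBasis
  have hk : ∀ k, (A - Matrix.scalar W (μ k)).mulVec (e k) = 0 := fun k => by
    rw [Matrix.sub_mulVec, hAe]
    ext v
    simp
  have hev : ∀ k, e k v ≠ 0 := fun k h0 => by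
    refine hA.eigenvectorBasis.orthonormal.ne_zero k ((WithLp.ofLp_eq_zero 2).1 ?_)
    exact hobs _ _ (hk k) h0
  have hinj : ∀ k l, k ≠ l → μ l - μ k ≠ 0 := fun k l hkl h0 => by
    obtain ⟨φ, h1, h2, h3⟩ := hA.exists_eigenvector_apply_eq_zero hkl (sub_eq_zero.1 h0).symm v
    exact h1 (hobs _ φ h3 h2)
  have hexp : ∀ ψ : W → ℝ, ∀ u, ψ u = ∑ k, (e k ⬝ᵥ ψ) * e k u := fun ψ u => by
    have h1 := congrArg (fun x : EuclideanSpace ℝ W => x u)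
      (hA.eigenvectorBasis.sum_repr' (WithLp.toLp 2 ψ))
    simp only [WithLp.ofLp_sum, Finset.sum_apply, WithLp.ofLp_smul, Pi.smul_apply, smul_eq_mul] at h1
    rw [← h1]
    refine Finset.sum_congr rfl fun k _ => ?_
    rw [EuclideanSpace.inner_eq_star_dotProduct, dotProduct_comm]
    rfl
  obtain ⟨k₀, hk₀⟩ : ∃ k, e k ⬝ᵥ b ≠ 0 := by
    by_contra! h
    exact hb (funext fun u => by simp [hexp b u, h])
  -- This is `det (A - t)` times the entry at `v` of `(A - t)⁻¹ b`, expanded in the eigenbasis; in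
  -- this form it also covers `t` an eigenvalue. At `t = μ k₀` only the term of `k₀` survives, and
  -- it is nonzero since the eigenvalues are distinct.
  let p : Polynomial ℝ := ∑ k, Polynomial.C ((e k ⬝ᵥ b) * e k v) *
    ∏ l ∈ Finset.univ.erase k, (Polynomial.C (μ l) - Polynomial.X)
  have hpe : ∀ t, p.eval t = ∑ k, (e k ⬝ᵥ b) * e k v * ∏ l ∈ Finset.univ.erase k, (μ l - t) :=
    fun t => by simp [p, Polynomial.eval_finsetSum, Polynomial.eval_prod]
  have hp0 : p ≠ 0 := fun h0 => by
    have h1 := hpe (μ k₀)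
    rw [h0, Polynomial.eval_zero, Finset.sum_eq_single k₀] at h1
    · refine mul_ne_zero (mul_ne_zero hk₀ (hev k₀)) (Finset.prod_ne_zero_iff.2 fun l hl => ?_) h1.symm
      exact hinj k₀ l (Finset.ne_of_mem_erase hl).symm
    · intro k _ hkk
      rw [Finset.prod_eq_zero (i := k₀) (by simp [hkk.symm]) (sub_self _), mul_zero]
    · simp
  refine (p.rootSet_finite ℝ).subset ?_
  rintro t ⟨ψ, hψv, hψ⟩
  rw [Polynomial.mem_rootSet, Polynomial.coe_aeval_eq_eval, hpe]
  refine ⟨hp0, ?_⟩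
  have h1 : ∀ k, e k ⬝ᵥ b = (μ k - t) * (e k ⬝ᵥ ψ) := fun k => by
    have hs : A.IsSymm := by
      rw [Matrix.IsSymm, ← Matrix.conjTranspose_eq_transpose_of_trivial]
      exact hA
    rw [← hψ, Matrix.sub_mulVec, dotProduct_sub, hs.dotProduct_mulVec_comm, hAe, smul_dotProduct]
    simp [sub_mul, dotProduct, Finset.mul_sum, mul_left_comm]
  have h2 : ∀ k, (e k ⬝ᵥ b) * e k v * ∏ l ∈ Finset.univ.erase k, (μ l - t)
      = (∏ l, (μ l - t)) * ((e k ⬝ᵥ ψ) * e k v) := fun k => by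
    rw [h1, ← Finset.mul_prod_erase _ _ (Finset.mem_univ k)]
    ring
  simp only [h2]
  rw [← Finset.mul_sum, ← hexp ψ v, hψv, mul_zero]

/-- No eigenvector of the block on `S` of the matrix `N` with the potential `V` added vanishes at
`v`. -/
def IsObservableOn (N : Matrix W W ℝ) (v : W) (S : Finset W) (V : W → ℝ) : Prop :=
  ∀ (t : ℝ) (ψ : W → ℝ), (∀ w, w ∉ S → ψ w = 0) →
    (∀ u ∈ S, N.mulVec ψ u + V u * ψ u = t * ψ u) → ψ v = 0 → ψ = 0

variable {N : Matrix W W ℝ} {v : W}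

/-- If every `T` failed, each would give an eigenvector vanishing at `v` with eigenvalue `t T`. It
is nonzero at `u`, so scale it to `1` there: its part on `S` solves `(A - t) χ = -N · u` with `χ v =
0`, which happens for finitely many `t` only. But `t` determines `χ` by observability on `S`, and
the row at `u` then determines `T`, so `t` would be injective on `ℝ`. -/
theorem IsObservableOn.exists_insert (hN : N.IsSymm) {S : Finset W} {V : W → ℝ} (hvS : v ∈ S)
    (hS : IsObservableOn N v S V) {u : W} (hu : u ∉ S) (hb : ∃ w ∈ S, N u w ≠ 0) :
    ∃ T, IsObservableOn N v (insert u S) (Function.update V u T) := by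
  by_contra! hcon
  have key : ∀ T : ℝ, ∃ (t : ℝ) (χ : W → ℝ), (∀ w, w ∉ S → χ w = 0) ∧ χ v = 0 ∧
      (∀ i ∈ S, N.mulVec χ i + V i * χ i - t * χ i = -N i u) ∧ T = t - N u u - N.mulVec χ u := by
    intro T
    have h1 := hcon T
    simp only [IsObservableOn] at h1
    push Not at h1
    obtain ⟨t, ψ, h2, h3, h4, h5⟩ := h1
    have hψu : ψ u ≠ 0 := by
      intro h6
      refine h5 (hS t ψ (fun w hw => ?_) (fun i hi => ?_) h4)
      · rcases eq_or_ne w u with rfl | hwu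
        · exact h6
        · exact h2 w (by simp [hw, hwu])
      · have h7 := h3 i (Finset.mem_insert_of_mem hi)
        rwa [Function.update_of_ne (by rintro rfl; exact hu hi)] at h7
    have hmul : ∀ i, N.mulVec ((ψ u)⁻¹ • ψ - Pi.single u 1) i = (ψ u)⁻¹ * N.mulVec ψ i - N i u := by
      intro i
      rw [Matrix.mulVec_sub, Matrix.mulVec_smul, Matrix.mulVec_single_one]
      rfl
    -- Subtracting the unit vector removes the entry `1` at `u`, leaving a vector supported on `S`.
    refine ⟨t, (ψ u)⁻¹ • ψ - Pi.single u 1, fun w hw => ?_, ?_, fun i hi => ?_, ?_⟩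
    · rcases eq_or_ne w u with rfl | hwu
      · simp [hψu]
      · simp [hwu, h2 w (by simp [hw, hwu])]
    · have hvu : v ≠ u := by rintro rfl; exact hu hvS
      simp [h4, hvu]
    · have hiu : i ≠ u := by rintro rfl; exact hu hi
      have h7 := h3 i (Finset.mem_insert_of_mem hi)
      rw [Function.update_of_ne hiu] at h7
      rw [hmul]
      simp only [Pi.sub_apply, Pi.smul_apply, smul_eq_mul, Pi.single_eq_of_ne hiu, sub_zero]
      linear_combination (ψ u)⁻¹ * h7
    · have h7 := h3 u (Finset.mem_insert_self u S)
      rw [Function.update_self] at h7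
      rw [hmul]
      field_simp
      linear_combination h7
  choose t χ h1 h2 h3 h4 using key
  let A : Matrix S S ℝ := N.submatrix (Subtype.val : S → W) (Subtype.val : S → W)
    + Matrix.diagonal fun i : S => V i
  have hA : A.IsHermitian := by
    rw [Matrix.IsHermitian, Matrix.conjTranspose_eq_transpose_of_trivial]
    exact (hN.submatrix _).add (Matrix.isSymm_diagonal _)
  have hAmul : ∀ (r : ℝ) (ψ : W → ℝ), (∀ w, w ∉ S → ψ w = 0) → ∀ i : S,
      (A - Matrix.scalar S r).mulVec (fun i => ψ i) i
        = N.mulVec ψ i + V i * ψ i - r * ψ i := by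
    intro r ψ hψ i
    rw [Matrix.sub_mulVec, Pi.sub_apply, Matrix.add_mulVec, Pi.add_apply,
      N.submatrix_val_mulVec (· ∈ S) hψ i, Matrix.mulVec_diagonal, Matrix.scalar_apply,
      Matrix.mulVec_diagonal]
  have hobs : ∀ (r : ℝ) (φ : S → ℝ), (A - Matrix.scalar S r).mulVec φ = 0 → φ ⟨v, hvS⟩ = 0 →
      φ = 0 := by
    intro r φ hφ hφv
    let ψ : W → ℝ := fun w => if h : w ∈ S then φ ⟨w, h⟩ else 0
    have hψ0 : ∀ w, w ∉ S → ψ w = 0 := fun w hw => dif_neg hw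
    have hψφ : (fun i : S => ψ i) = φ := by
      ext i
      simp [ψ]
    have h5 : ψ = 0 := by
      refine hS r ψ hψ0 (fun i hi => ?_) (by simpa [ψ, hvS] using hφv)
      have h6 := hAmul r ψ hψ0 ⟨i, hi⟩
      rw [hψφ, hφ] at h6
      exact (sub_eq_zero.1 h6.symm)
    rw [← hψφ, h5]
    rfl
  have hfin := hA.finite_setOf_solution_apply_eq_zero hobs (b := fun i : S => -N i u) (by
    obtain ⟨w, hw, hwu⟩ := hb
    intro h0
    exact hwu (by simpa [hN.apply] using congrFun h0 ⟨w, hw⟩))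
  have hmem : ∀ T, t T ∈ {r : ℝ | ∃ ψ : S → ℝ, ψ ⟨v, hvS⟩ = 0 ∧
      (A - Matrix.scalar S r).mulVec ψ = fun i : S => -N i u} := fun T =>
    ⟨fun i => χ T i, h2 T, funext fun i => (hAmul _ _ (h1 T) i).trans (h3 T i i.2)⟩
  have hinj : Function.Injective t := by
    intro T T' hT
    have h5 : χ T - χ T' = 0 := by
      refine hS (t T) _ (fun w hw => by simp [h1 _ w hw]) (fun i hi => ?_) (by simp [h2])
      have h6 := h3 T i hi
      have h7 := h3 T' i hi
      rw [← hT] at h7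
      rw [Matrix.mulVec_sub, Pi.sub_apply, Pi.sub_apply]
      linear_combination h6 - h7
    rw [h4 T, h4 T', hT, sub_eq_zero.1 h5]
  exact Set.infinite_of_injective_forall_mem hinj hmem hfin

/-- Start from `{v}`, where observability is trivial, and take a set of maximal size; it has no
neighbour outside, so connectedness makes it everything. -/
theorem exists_isObservableOn_univ (hN : N.IsSymm)
    (hconn : ∀ S : Finset W, v ∈ S → (∀ u, u ∉ S → ∀ w ∈ S, N u w = 0) → S = Finset.univ) :
    ∃ V, IsObservableOn N v Finset.univ V := by
  classical
  obtain ⟨S, hS, hmax⟩ := (Finset.univ.filter fun S : Finset W =>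
    v ∈ S ∧ ∃ V, IsObservableOn N v S V).exists_max_image Finset.card ⟨{v}, by
      refine Finset.mem_filter.2 ⟨Finset.mem_univ _, Finset.mem_singleton_self v, 0, ?_⟩
      intro t ψ h1 _ h2
      ext w
      rcases eq_or_ne w v with rfl | hw
      · exact h2
      · exact h1 w (by simpa using hw)⟩
  obtain ⟨-, hvS, V, hV⟩ := Finset.mem_filter.1 hS
  suffices h : S = Finset.univ from ⟨V, h ▸ hV⟩
  refine hconn S hvS fun u hu w hw => ?_
  by_contra hne
  obtain ⟨T, hT⟩ := hV.exists_insert hN hvS hu ⟨w, hw, hne⟩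
  have h1 := hmax (insert u S) (Finset.mem_filter.2
    ⟨Finset.mem_univ _, Finset.mem_insert_of_mem hvS, _, hT⟩)
  rw [Finset.card_insert_of_notMem hu] at h1
  omega

/-- An eigenvalue of a real symmetric matrix is real, so the real and imaginary parts of `φ` satisfy
the same real equation. -/
theorem IsObservableOn.complex {V : W → ℝ} (hN : N.IsSymm) (hV : IsObservableOn N v Finset.univ V)
    (t : ℂ) (φ : W → ℂ)
    (hφ : ((N + Matrix.diagonal V).map Complex.ofRealHom - Matrix.scalar W t).mulVec φ = 0)
    (hφv : φ v = 0) : φ = 0 := by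
  by_contra h0
  have hA : ((N + Matrix.diagonal V).map Complex.ofRealHom).IsHermitian := by
    ext i j
    simp [(hN.add (Matrix.isSymm_diagonal V)).apply]
  have hdet := Matrix.exists_mulVec_eq_zero_iff.1 ⟨φ, h0, hφ⟩
  rw [hA.det_sub_scalar, Finset.prod_eq_zero_iff] at hdet
  obtain ⟨i, -, hi⟩ := hdet
  obtain rfl := sub_eq_zero.1 hi
  set r := hA.eigenvalues i
  have hrow : ∀ u, ∑ w, ((N u w : ℝ) : ℂ) * φ w + (V u : ℂ) * φ u - (r : ℂ) * φ u = 0 := by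
    intro u
    have h1 := congrFun hφ u
    rw [Matrix.map_add _ (map_add _), Matrix.sub_mulVec, Matrix.add_mulVec,
      Matrix.diagonal_map (map_zero _), Matrix.scalar_apply] at h1
    simpa [Matrix.diagonal_apply, Matrix.mulVec, dotProduct] using h1
  have hre : (fun u => (φ u).re) = 0 := by
    refine hV r _ (by simp) (fun u _ => ?_) (by simp [hφv])
    have h1 := congrArg Complex.re (hrow u)
    simp at h1
    simp only [Matrix.mulVec, dotProduct]
    linarith
  have him : (fun u => (φ u).im) = 0 := by
    refine hV r _ (by simp) (fun u _ => ?_) (by simp [hφv])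
    have h1 := congrArg Complex.im (hrow u)
    simp at h1
    simp only [Matrix.mulVec, dotProduct]
    linarith
  exact h0 (funext fun u => Complex.ext (congrFun hre u) (congrFun him u))

end Observable

namespace IsthmusGraph

/-! ### Connectedness of the isthmus graph -/

section Connected

variable {G : IsthmusGraph}

theorem reachable_isthmusVert (i : Fin G.m) (v : G.Vert) :
    G.graph.Reachable (G.isthmusVert i) v := by
  have hpos : 0 < G.m := i.pos
  have h0 : ∀ (n : ℕ) (hn : n < G.m),
      G.graph.Reachable (G.isthmusVert ⟨0, hpos⟩) (G.isthmusVert ⟨n, hn⟩) := by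
    intro n
    induction n with
    | zero => exact fun _ => SimpleGraph.Reachable.refl _
    | succ n ih =>
      intro hn
      refine (ih (by omega)).trans (SimpleGraph.Adj.reachable (adj_of_idx ?_ ?_ ?_)) <;>
        simp only [idx_isthmusVert] <;> omega
  refine (h0 i i.2).symm.trans ?_
  rcases v with u | u | u
  · have ha : 0 < G.a := u.pos
    have h1 : G.graph.Adj (.inl ⟨G.a - 1, by omega⟩) (G.isthmusVert ⟨0, hpos⟩) := by
      rw [graph, SimpleGraph.fromRel_adj]
      refine ⟨by simp [isthmusVert], Or.inl ⟨?_, rfl⟩⟩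
      simp only
      omega
    let F : G.A →g G.graph := ⟨fun u => .inl u, fun {u v} h => by
      rw [graph, SimpleGraph.fromRel_adj]
      exact ⟨fun h' => h.ne (Sum.inl_injective h'), Or.inl h⟩⟩
    exact h1.symm.reachable.trans ((G.preconnected_A _ u).map F)
  · exact h0 u u.2
  · have hb : 0 < G.b := u.pos
    have h1 : G.graph.Adj (G.isthmusVert ⟨G.m - 1, by omega⟩) (.inr (.inr ⟨0, hb⟩)) := by
      rw [graph, SimpleGraph.fromRel_adj]
      refine ⟨by simp [isthmusVert], Or.inl ⟨?_, rfl⟩⟩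
      simp only
      omega
    let F : G.B →g G.graph := ⟨fun u => .inr (.inr u), fun {u v} h => by
      rw [graph, SimpleGraph.fromRel_adj]
      exact ⟨fun h' => h.ne (Sum.inr_injective (Sum.inr_injective h')), Or.inl h⟩⟩
    exact ((h0 _ _).trans h1.reachable).trans ((G.preconnected_B _ u).map F)

theorem eq_univ_of_closed_adj {S : Finset G.Vert} {i : Fin G.m} (hi : G.isthmusVert i ∈ S)
    (hS : ∀ u, u ∉ S → ∀ w ∈ S, ¬ G.graph.Adj u w) : S = Finset.univ := by
  refine Finset.eq_univ_of_forall fun v => ?_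
  have h1 := (SimpleGraph.reachable_iff_reflTransGen _ _).1 (reachable_isthmusVert i v)
  induction h1 with
  | refl => exact hi
  | tail _ h2 ih =>
    by_contra h3
    exact hS _ h3 _ ih h2.symm

end Connected

variable {G : IsthmusGraph} {d : ℕ} {f : Fin d → Fin G.m}

/-! ### Generic Schrödinger operators -/

/-- The labeling with a given potential whose edge weights are all `1`. -/
def schrodingerLabeling (f : Fin d → Fin G.m) (V : G.Vert → ℝ) : Labeling (G.periodicGraph f) where
  V p := V p.2
  E _ := 1
  V_periodic _ _ := rfl
  E_periodic _ _ _ _ := rfl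

/-- A property holds for all labelings away from the vanishing of a polynomial that does not vanish
identically on the labelings with edge weights `1`. -/
def HoldsForGenericPotential (P : Labeling (G.periodicGraph f) → Prop) : Prop :=
  ∃ F : MvPolynomial (Params G f) ℝ, (∃ V, (schrodingerLabeling f V).evalParams F ≠ 0) ∧
    ∀ L : Labeling (G.periodicGraph f), L.evalParams F ≠ 0 → P L

theorem HoldsForGenericPotential.mono {P Q : Labeling (G.periodicGraph f) → Prop}
    (h : HoldsForGenericPotential P) (hPQ : ∀ L, P L → Q L) : HoldsForGenericPotential Q :=
  h.imp fun _ hF => ⟨hF.1, fun L hL => hPQ L (hF.2 L hL)⟩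

/-- The restriction of a polynomial in the parameters to the labelings with edge weights `1`. -/
def restrictPotential (F : MvPolynomial (Params G f) ℝ) : MvPolynomial G.Vert ℝ :=
  MvPolynomial.aeval (Sum.elim (fun p => MvPolynomial.X p.2) fun _ => 1) F

theorem eval_restrictPotential (V : G.Vert → ℝ) (F : MvPolynomial (Params G f) ℝ) :
    MvPolynomial.eval V (restrictPotential F) = (schrodingerLabeling f V).evalParams F := by
  rw [restrictPotential, Labeling.evalParams, MvPolynomial.aeval_def, MvPolynomial.eval_eval₂,
    ← MvPolynomial.eval₂_id]
  congr 1
  · ext r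
    simp
  · ext p
    rcases p with p | e <;> simp [schrodingerLabeling]

theorem restrictPotential_ne_zero_iff (F : MvPolynomial (Params G f) ℝ) :
    restrictPotential F ≠ 0 ↔ ∃ V, (schrodingerLabeling f V).evalParams F ≠ 0 := by
  rw [← not_iff_not]
  push Not
  simp only [← eval_restrictPotential]
  exact ⟨fun h V => by rw [h, map_zero], fun h => MvPolynomial.funext fun V => by rw [h, map_zero]⟩

/-- After restriction to edge weights `1` the polynomials live in an integral domain, so a finite
product of nonzero ones is nonzero. The witnessing potentials may differ from one `i` to another. -/
theorem HoldsForGenericPotential.forall {ι : Type} [Finite ι]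
    {P : ι → Labeling (G.periodicGraph f) → Prop} (h : ∀ i, HoldsForGenericPotential (P i)) :
    HoldsForGenericPotential fun L => ∀ i, P i L := by
  cases nonempty_fintype ι
  choose F h1 h2 using h
  refine ⟨∏ i, F i, ?_, fun L hL i => h2 i L fun h0 => hL ?_⟩
  · rw [← restrictPotential_ne_zero_iff, restrictPotential, map_prod, Finset.prod_ne_zero_iff]
    exact fun i _ => (restrictPotential_ne_zero_iff _).2 (h1 i)
  · rw [Labeling.evalParams, map_prod]
    exact Finset.prod_eq_zero (Finset.mem_univ i) h0

theorem HoldsForGenericPotential.and {P Q : Labeling (G.periodicGraph f) → Prop}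
    (hP : HoldsForGenericPotential P) (hQ : HoldsForGenericPotential Q) :
    HoldsForGenericPotential fun L => P L ∧ Q L :=
  (HoldsForGenericPotential.forall (ι := Bool) (P := fun i L => if i then P L else Q L)
    (by rintro (_ | _) <;> simpa)).mono fun L hL => ⟨by simpa using hL true, by simpa using hL false⟩

/-- There are infinitely many edges, but each has a translate starting in the cell at `0`, and those
are finite in number; periodicity does the rest. -/
theorem holdsForGenericPotential_edges :
    HoldsForGenericPotential fun L : Labeling (G.periodicGraph f) => ∀ e, L.E e ≠ 0 := by
  have hfin : ∀ v u, Finite {c : Fin d → ℤ // (G.periodicGraph f).graph.Adj (0, v) (c, u)} :=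
    fun v u => (G.periodicGraph f).cocompact v u
  refine (HoldsForGenericPotential.forall
    (ι := Σ v u, {c : Fin d → ℤ // (G.periodicGraph f).graph.Adj (0, v) (c, u)})
    (P := fun i L => L.E ⟨s((0, i.1), (i.2.2.1, i.2.1)), i.2.2.2⟩ ≠ 0) fun i =>
      ⟨MvPolynomial.X (.inr ⟨s((0, i.1), (i.2.2.1, i.2.1)), i.2.2.2⟩), ⟨0, ?_⟩, fun L hL => ?_⟩).mono
    fun L hL => ?_
  · simp [Labeling.evalParams, schrodingerLabeling]
  · simpa [Labeling.evalParams] using hL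
  · rintro ⟨e, he⟩
    induction e using Sym2.ind with
    | h p q =>
      have h1 : (G.periodicGraph f).graph.Adj p q := he
      have h2 := (G.periodicGraph f).periodic (-p.1) p q h1
      have h3 : shiftVert (-p.1) p = (0, p.2) := by simp [shiftVert]
      rw [← L.E_periodic (-p.1) p q h1]
      have h4 := hL ⟨p.2, q.2, -p.1 + q.1, by simpa [shiftVert] using h2⟩
      exact fun h0 => h4 (Eq.trans (congrArg L.E (Subtype.ext (by simp [shiftVert]))) h0)

/-! ### Resultants at corner points and potentials where they do not vanish -/

section Corner

/-- The corner point with given signs. -/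
def cornerPoint (ε : Fin d → Bool) : Fin d → ℂ := fun j => if ε j then 1 else -1

theorem exists_eq_cornerPoint {x : Fin d → ℂ} (hx : IsCornerPoint x) : ∃ ε, x = cornerPoint ε := by
  classical
  refine ⟨fun j => decide (x j = 1), funext fun j => ?_⟩
  rcases hx j with h | h
  · simp [cornerPoint, h]
  · have h1 : (-1 : ℂ) ≠ 1 := by norm_num
    simp [cornerPoint, h, h1]

/-- The Floquet matrix at a corner point, with coefficients in any ring. -/
def cornerMatrix {R : Type} [CommRing R] (c : Params G f → R) (ε : Fin d → Bool) :
    Matrix G.Vert G.Vert R :=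
  diagFamily (baseMatrix c) (fun j => G.isthmusVert (f j)) (hopWeight c)
    fun j => if ε j then 2 else -2

theorem cornerMatrix_map {R S : Type} [CommRing R] [CommRing S] (φ : R →+* S) (c : Params G f → R)
    (ε : Fin d → Bool) : (cornerMatrix c ε).map φ = cornerMatrix (φ ∘ c) ε := by
  rw [cornerMatrix, diagFamily_map, baseMatrix_map, cornerMatrix]
  congr 1
  ext j
  simp [apply_ite φ, map_ofNat]

theorem cornerMatrix_isSymm (c : Params G f → ℝ) (ε : Fin d → Bool) : (cornerMatrix c ε).IsSymm :=
  diagFamily_isSymm (baseMatrix_isSymm c) _ _ _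

theorem charMat_cornerPoint (L : Labeling (G.periodicGraph f)) (ε : Fin d → Bool) (t : ℂ) :
    L.charMat (cornerPoint ε, t)
      = (cornerMatrix (Sum.elim L.V L.E) ε).map Complex.ofRealHom - Matrix.scalar G.Vert t := by
  rw [Labeling.charMat, hasDiagForm L, cornerMatrix, diagFamily_map]
  congr 2
  ext j
  simp only [cornerPoint, Function.comp_apply]
  split_ifs <;> norm_num

theorem det_submatrix_charMat_eq_zero_iff (L : Labeling (G.periodicGraph f)) (ε : Fin d → Bool)
    {α : Type} [Fintype α] [DecidableEq α] {a : α → G.Vert} (ha : Function.Injective a) (t : ℂ) :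
    ((L.charMat (cornerPoint ε, t)).submatrix a a).det = 0 ↔ Polynomial.aeval t
      ((cornerMatrix (Sum.elim L.V L.E) ε).submatrix a a).charpoly = 0 := by
  have h1 : (L.charMat (cornerPoint ε, t)).submatrix a a
      = ((cornerMatrix (Sum.elim L.V L.E) ε).submatrix a a).map Complex.ofRealHom
        - Matrix.scalar α t := by
    rw [charMat_cornerPoint]
    ext i j
    rcases eq_or_ne i j with rfl | hij
    · simp
    · simp [hij, ha.ne hij]
  rw [h1, Matrix.det_sub_scalar_eq_charpoly, mul_eq_zero, Matrix.charpoly_map,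
    Polynomial.eval_map, or_iff_right (pow_ne_zero _ (by norm_num))]
  rfl

/-- The excluding polynomial is the resultant of the two characteristic polynomials with
indeterminate parameters. These are monic, so their degrees, and hence the resultant, are preserved
under evaluation; a unit resultant means coprimality over `ℝ`, that is, no common root in `ℂ`. -/
theorem holdsForGenericPotential_no_common_root (ε : Fin d → Bool) {α β : Type} [Fintype α]
    [DecidableEq α] [Fintype β] [DecidableEq β] {a : α → G.Vert} {b : β → G.Vert}
    (ha : Function.Injective a) (hb : Function.Injective b)
    (h : ∃ V, ∀ t, ¬ ((((schrodingerLabeling f V).charMat (cornerPoint ε, t)).submatrix a a).det = 0 ∧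
      (((schrodingerLabeling f V).charMat (cornerPoint ε, t)).submatrix b b).det = 0)) :
    HoldsForGenericPotential fun L : Labeling (G.periodicGraph f) => ∀ t,
      ¬ (((L.charMat (cornerPoint ε, t)).submatrix a a).det = 0 ∧
        ((L.charMat (cornerPoint ε, t)).submatrix b b).det = 0) := by
  have hcop : ∀ L : Labeling (G.periodicGraph f), (∀ t,
      ¬ (((L.charMat (cornerPoint ε, t)).submatrix a a).det = 0 ∧
        ((L.charMat (cornerPoint ε, t)).submatrix b b).det = 0)) ↔
      IsCoprime ((cornerMatrix (Sum.elim L.V L.E) ε).submatrix a a).charpoly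
        ((cornerMatrix (Sum.elim L.V L.E) ε).submatrix b b).charpoly := by
    intro L
    rw [Polynomial.isCoprime_iff_aeval_ne_zero_of_isAlgClosed ℝ ℂ]
    refine forall_congr' fun t => ?_
    rw [det_submatrix_charMat_eq_zero_iff L ε ha, det_submatrix_charMat_eq_zero_iff L ε hb,
      not_and_or]
  have heval : ∀ L : Labeling (G.periodicGraph f), L.evalParams (Polynomial.resultant
      ((cornerMatrix (MvPolynomial.X : Params G f → MvPolynomial (Params G f) ℝ) ε).submatrix a
        a).charpoly
      ((cornerMatrix (MvPolynomial.X : Params G f → MvPolynomial (Params G f) ℝ) ε).submatrix b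
        b).charpoly) ≠ 0 ↔
      IsCoprime ((cornerMatrix (Sum.elim L.V L.E) ε).submatrix a a).charpoly
        ((cornerMatrix (Sum.elim L.V L.E) ε).submatrix b b).charpoly := by
    intro L
    have hmap : ∀ {γ : Type} [Fintype γ] [DecidableEq γ] (c : γ → G.Vert),
        ((cornerMatrix (MvPolynomial.X : Params G f → MvPolynomial (Params G f) ℝ) ε).submatrix c
          c).charpoly.map (MvPolynomial.eval (Sum.elim L.V L.E))
        = ((cornerMatrix (Sum.elim L.V L.E) ε).submatrix c c).charpoly := by
      intro γ _ _ c
      rw [← Matrix.charpoly_map, ← Matrix.submatrix_map, cornerMatrix_map]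
      congr 3
      ext p
      simp
    rw [← Polynomial.isUnit_resultant_iff_isCoprime (Matrix.charpoly_monic _), isUnit_iff_ne_zero,
      Labeling.evalParams, ← Polynomial.resultant_map_map, hmap, hmap]
    simp only [Matrix.charpoly_natDegree_eq_dim]
  obtain ⟨V, hV⟩ := h
  exact ⟨_, ⟨V, (heval _).2 ((hcop _).1 hV)⟩, fun L hL => (hcop L).2 ((heval L).1 hL)⟩

theorem charMat_schrodingerLabeling (V : G.Vert → ℝ) (ε : Fin d → Bool) (t : ℂ) :
    (schrodingerLabeling f V).charMat (cornerPoint ε, t)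
      = (cornerMatrix (Sum.elim 0 1 : Params G f → ℝ) ε + Matrix.diagonal V).map Complex.ofRealHom
        - Matrix.scalar G.Vert t := by
  rw [charMat_cornerPoint]
  congr 2
  have h1 : baseMatrix (Sum.elim (schrodingerLabeling f V).V (schrodingerLabeling f V).E)
      = baseMatrix (Sum.elim 0 1 : Params G f → ℝ) + Matrix.diagonal V := by
    ext u v
    rcases eq_or_ne u v with rfl | huv
    · simp [baseMatrix, schrodingerLabeling]
    · simp [baseMatrix, schrodingerLabeling, huv]
  rw [cornerMatrix, cornerMatrix, h1, diagFamily, diagFamily, add_right_comm]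
  rfl

/-- Adding a constant `T` right of `s` translates the roots of `Q_s` by `T` and leaves `P_r` alone,
because `r ≤ s`. It suffices that `T` avoid the finitely many differences of roots. -/
theorem exists_potential_disjoint (ε : Fin d → Bool) {r s : ℤ} (hrs : r ≤ s) :
    ∃ V, ∀ t, ¬ (minorP (schrodingerLabeling f V) r (cornerPoint ε, t) = 0 ∧
      minorQ (schrodingerLabeling f V) s (cornerPoint ε, t) = 0) := by
  set L₀ := schrodingerLabeling f (0 : G.Vert → ℝ) with hL₀
  have hfin : ∀ (p : G.Vert → Prop) [DecidablePred p],
      {t | ((L₀.charMat (cornerPoint ε, t)).submatrix (Subtype.val : {v // p v} → G.Vert)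
        (Subtype.val : {v // p v} → G.Vert)).det = 0}.Finite := by
    intro p _
    simp only [det_submatrix_charMat_eq_zero_iff L₀ ε Subtype.val_injective]
    refine (Polynomial.rootSet_finite ((cornerMatrix (Sum.elim L₀.V L₀.E) ε).submatrix
      (Subtype.val : {v // p v} → G.Vert) Subtype.val).charpoly ℂ).subset fun t ht => ?_
    exact Polynomial.mem_rootSet.2 ⟨(Matrix.charpoly_monic _).ne_zero, ht⟩
  have hdiff := ((hfin fun v => G.idx v < r).prod (hfin fun v => s < G.idx v)).image
    fun q => q.1 - q.2
  obtain ⟨T, hT⟩ := (hdiff.preimage (f := Complex.ofReal)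
    Complex.ofReal_injective.injOn).infinite_compl.nonempty
  refine ⟨fun v => if s < G.idx v then T else 0, fun t ht => hT ?_⟩
  refine ⟨(t, t - T), ⟨?_, ?_⟩, by simp⟩
  · refine Eq.trans (congrArg Matrix.det ?_) ht.1
    ext u v
    rw [charMat_schrodingerLabeling, charMat_schrodingerLabeling]
    rcases eq_or_ne u v with rfl | huv
    · have h1 := u.2
      simp [show ¬ s < G.idx u by omega]
    · simp [Subtype.val_injective.ne huv]
  · refine Eq.trans (congrArg Matrix.det ?_) ht.2
    ext u v
    rw [charMat_schrodingerLabeling, charMat_schrodingerLabeling]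
    rcases eq_or_ne u v with rfl | huv
    · simp [u.2]
      ring
    · simp [Subtype.val_injective.ne huv]

/-- Take `V` for which no eigenvector vanishes at the vertex of position `r`. Where `D = 0`, the
minor omitting that vertex is then nonzero, whereas a kernel vector of the left or right block,
extended by zero, would make it vanish. -/
theorem exists_potential_observable (f : Fin d → Fin G.m) (ε : Fin d → Bool) {r : ℤ} (h1 : 1 ≤ r)
    (h2 : r ≤ G.m) :
    ∃ V, ∀ t, (schrodingerLabeling f V).dispersion (cornerPoint ε, t) = 0 →
      minorP (schrodingerLabeling f V) r (cornerPoint ε, t) ≠ 0 ∧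
      minorQ (schrodingerLabeling f V) r (cornerPoint ε, t) ≠ 0 := by
  set i : Fin G.m := ⟨(r - 1).toNat, by omega⟩ with hi
  have hidx : G.idx (G.isthmusVert i) = r := by
    rw [idx_isthmusVert]
    simp [hi]
    omega
  have hN : (cornerMatrix (Sum.elim 0 1 : Params G f → ℝ) ε).IsSymm := cornerMatrix_isSymm _ ε
  obtain ⟨V, hV⟩ := exists_isObservableOn_univ hN (v := G.isthmusVert i) fun S hS hclosed =>
    eq_univ_of_closed_adj hS fun u hu w hw hadj => by
      have h3 := hclosed u hu w hw
      rw [cornerMatrix, diagFamily, Matrix.add_apply, Matrix.diagonal_apply_ne _ hadj.ne,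
        add_zero] at h3
      exact baseMatrix_ne_zero (c := (Sum.elim 0 1 : Params G f → ℝ)) (fun e => one_ne_zero) hadj h3
  refine ⟨V, fun t hdet => ?_⟩
  have hI := isIsthmusMatrix (schrodingerLabeling f V) (fun _ => one_ne_zero) (cornerPoint ε, t)
  have hadj := Matrix.adjugate_ne_zero_of_symm hI.symm hdet (s := G.isthmusVert i) (by
    rw [charMat_schrodingerLabeling]
    exact hV.complex hN t)
  have key : ∀ φ : G.Vert → ℂ, φ ≠ 0 → φ (G.isthmusVert i) = 0 →
      (∀ v, v ≠ G.isthmusVert i →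
        ((schrodingerLabeling f V).charMat (cornerPoint ε, t)).mulVec φ v = 0) → False :=
    fun φ h3 h4 h5 => hadj ((Matrix.adjugate_self_eq_zero_iff _ _).2 ⟨φ, h3, h4, h5⟩)
  refine ⟨fun h => ?_, fun h => ?_⟩
  · obtain ⟨φ, h3, h4, h5⟩ := (Matrix.det_submatrix_val_eq_zero_iff _ _).1 h
    refine key φ h3 (h4 _ (by omega)) fun v hv => ?_
    rcases lt_trichotomy (G.idx v) r with h6 | h6 | h6
    · exact h5 v h6
    · exact absurd (eq_of_idx_eq (by omega) (by omega) (h6.trans hidx.symm)) hv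
    · rw [Matrix.mulVec, dotProduct]
      refine Finset.sum_eq_zero fun w _ => ?_
      by_cases hw : G.idx w < r
      · rw [← hI.symm.apply, hI.cut w v r h1 h2 hw h6, zero_mul]
      · rw [h4 w hw, mul_zero]
  · obtain ⟨φ, h3, h4, h5⟩ := (Matrix.det_submatrix_val_eq_zero_iff _ _).1 h
    refine key φ h3 (h4 _ (by omega)) fun v hv => ?_
    rcases lt_trichotomy (G.idx v) r with h6 | h6 | h6
    · rw [Matrix.mulVec, dotProduct]
      refine Finset.sum_eq_zero fun w _ => ?_
      by_cases hw : r < G.idx w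
      · rw [hI.cut v w r h1 h2 h6 hw, zero_mul]
      · rw [h4 w hw, mul_zero]
    · exact absurd (eq_of_idx_eq (by omega) (by omega) (h6.trans hidx.symm)) hv
    · exact h5 v h6

end Corner

theorem holdsForGenericPotential_isGeneric (f : Fin d → Fin G.m) :
    HoldsForGenericPotential (IsGeneric : Labeling (G.periodicGraph f) → Prop) := by
  have hfin : Finite {q : ℤ × ℤ // 1 ≤ q.1 ∧ q.1 ≤ q.2 ∧ q.2 ≤ G.m} :=
    Set.Finite.subset (t := {q : ℤ × ℤ | 1 ≤ q.1 ∧ q.1 ≤ q.2 ∧ q.2 ≤ G.m})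
      ((Set.finite_Icc (1 : ℤ) G.m).prod (Set.finite_Icc (1 : ℤ) G.m)) fun q hq =>
        ⟨⟨hq.1, hq.2.1.trans hq.2.2⟩, ⟨hq.1.trans hq.2.1, hq.2.2⟩⟩
  -- `D` is written as the minor on all vertices, `submatrix id id`, to fit the common-root
  -- criterion for minors.
  have h := HoldsForGenericPotential.forall (f := f)
    (ι := (Fin d → Bool) × {q : ℤ × ℤ // 1 ≤ q.1 ∧ q.1 ≤ q.2 ∧ q.2 ≤ G.m})
    (P := fun i L =>
      (∀ t, ¬ (minorP L i.2.1.1 (cornerPoint i.1, t) = 0 ∧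
        minorQ L i.2.1.2 (cornerPoint i.1, t) = 0)) ∧
      (∀ t, ¬ (minorP L i.2.1.1 (cornerPoint i.1, t) = 0 ∧
        ((L.charMat (cornerPoint i.1, t)).submatrix id id).det = 0)) ∧
      ∀ t, ¬ (minorQ L i.2.1.2 (cornerPoint i.1, t) = 0 ∧
        ((L.charMat (cornerPoint i.1, t)).submatrix id id).det = 0)) (by
      rintro ⟨ε, ⟨r, s⟩, h1, h2, h3⟩
      dsimp only at h1 h2 h3
      refine (holdsForGenericPotential_no_common_root ε Subtype.val_injective
        Subtype.val_injective (exists_potential_disjoint ε h2)).and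
        ((holdsForGenericPotential_no_common_root ε Subtype.val_injective
          Function.injective_id ?_).and (holdsForGenericPotential_no_common_root ε
          Subtype.val_injective Function.injective_id ?_))
      · obtain ⟨V, hV⟩ := exists_potential_observable f ε h1 (h2.trans h3)
        exact ⟨V, fun t ht => (hV t ht.2).1 ht.1⟩
      · obtain ⟨V, hV⟩ := exists_potential_observable f ε (h1.trans h2) h3
        exact ⟨V, fun t ht => (hV t ht.2).2 ht.1⟩)
  refine (holdsForGenericPotential_edges.and h).mono fun L hL => ⟨hL.1, ?_⟩
  intro x hx r s h1 h2 h3 t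
  obtain ⟨ε, rfl⟩ := exists_eq_cornerPoint hx
  obtain ⟨g1, g2, g3⟩ := hL.2 (ε, ⟨(r, s), h1, h2, h3⟩)
  exact ⟨g1 t, g2 t, g3 t⟩

end IsthmusGraph

/-- One polynomial serves for both conjectures: it is nonzero at a labeling with all edge weights
`1`, and its nonvanishing implies genericity for arbitrary weights. -/
theorem mainTheorem5 {d : ℕ} (hd : 0 < d) (G : IsthmusGraph) (f : Fin d → Fin G.m) :
    (∀ L : Labeling (G.periodicGraph f), IsthmusGraph.IsGeneric L →
      (∀ p : (Fin d → ℂ) × ℂ, L.IsCritical p ↔ p ∈ L.blochVariety ∧ IsCornerPoint p.1) ∧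
      (∀ p : (Fin d → ℂ) × ℂ, L.IsCritical p → L.IsNondegenerate p)) ∧
    SpectralEdgesConjecture (G.periodicGraph f) ∧
    SchrodingerSpectralEdgesConjecture (G.periodicGraph f) := by
  obtain ⟨F, ⟨V, hV⟩, hF⟩ := IsthmusGraph.holdsForGenericPotential_isGeneric f
  exact ⟨fun L hL => ⟨hL.isCritical_iff, fun p => hL.isNondegenerate hd⟩,
    ⟨F, ⟨_, trivial, hV⟩, fun L _ h => (hF L h).hasGoodSpectralEdges hd⟩,
    ⟨F, ⟨IsthmusGraph.schrodingerLabeling f V, fun _ => rfl, hV⟩,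
      fun L _ h => (hF L h).hasGoodSpectralEdges hd⟩⟩

end
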